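/- Let $\mathbb{D}$ be the open unit disc in the complex plane. For $0<p<\infty$, $0<r<1$ and $f$ analytic in $\mathbb{D}$, let \[M_p^p(r,f) = \int_0^{2\pi} |f(re^{i\theta})|^p\,\frac{d\theta}{2\pi}.\] The function $r\mapsto M_p^p(r,f)$ is increasing and differentiable on $(0,1)$. For $0<\alpha<\infty$, define $\|f\|_{\alpha,p}\in[0,\infty]$ by \[\|f\|_{\alpha,p}^p = |f(0)|^p+\int_0^1\left(\frac{d}{dr}M_p^p(r,f)\right)(1-r^2)^{\alpha-1}\,dr,\] and let $A^p_\alpha$ be the class of all analytic functions $f$ in $\mathbb{D}$ with $\|f\|_{\alpha,p}<\infty$. For $w\in\mathbb{D}$ and $\kappa>0$, let \[T_{w,\kappa}f(z) = f\left(\frac{w-z}{1-\overline{w}z}\right)\frac{(1-|w|^2)^\kappa}{(1-\overline{w}z)^{2\kappa}},\qquad z\in\mathbb{D},\] where the power in the denominator is the principal branch. Theorem. Fix $0<\alpha<\infty$ and $0<p<\infty$. If $f$ is in $A^p_\alpha$, then $T_{w,\alpha/p}f$ is in $A^p_\alpha$ for every $w\in\mathbb{D}$, and \[\|f\|_{\alpha,p}=\|T_{w,\alpha/p}f\|_{\alpha,p}.\]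 -/

import Mathlib

open scoped ENNReal ComplexConjugate

noncomputable section

/-- The integral mean `M_p^p(r,f) = ∫_0^{2π} |f(r e^{iθ})|^p dθ/(2π)`. -/
def integralMean (p : ℝ) (f : ℂ → ℂ) (r : ℝ) : ℝ :=
  Real.circleAverage (fun z : ℂ => ‖f z‖ ^ p) 0 r

/-- The quantity `‖f‖_{α,p}`, with values in `[0,∞]`, given by
`‖f‖_{α,p}^p = |f(0)|^p + ∫_0^1 (d/dr M_p^p(r,f)) (1 - r^2)^(α-1) dr`.
For `f` analytic in the unit disc and `p > 0` the function `r ↦ M_p^p(r,f)` is increasing and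
differentiable on `(0,1)`, so that the integrand is a nonnegative function, and the
integral is its Lebesgue integral, which may be infinite. -/
def dirichletNorm (α p : ℝ) (f : ℂ → ℂ) : ℝ≥0∞ :=
  (ENNReal.ofReal (‖f 0‖ ^ p) +
    ∫⁻ r in Set.Ioo (0 : ℝ) 1,
      ENNReal.ofReal (deriv (integralMean p f) r * (1 - r ^ 2) ^ (α - 1))) ^ (1 / p)

/-- The class `A^p_α` of the functions that are analytic in the open unit disc and have
`‖f‖_{α,p} < ∞`. A function on the disc is represented by a function on `ℂ`, whose
values outside of the disc play no role. -/
def classA (α p : ℝ) : Set (ℂ → ℂ) :=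
  {f | DifferentiableOn ℂ f (Metric.ball 0 1) ∧ dirichletNorm α p f < ∞}

/-- The weighted Möbius operator
`T_{w,κ} f(z) = f((w - z)/(1 - w̄ z)) (1 - |w|^2)^κ / (1 - w̄ z)^(2κ)`. The power in the
denominator is the principal branch, which is analytic in `z` in the unit disc for `|w| < 1`,
as `1 - w̄ z` has positive real part there. -/
def moebiusOp (w : ℂ) (κ : ℝ) (f : ℂ → ℂ) : ℂ → ℂ := fun z =>
  f ((w - z) / (1 - conj w * z)) *
    (((1 - ‖w‖ ^ 2) ^ κ : ℝ) / (1 - conj w * z) ^ ((2 * κ : ℝ) : ℂ))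

end

open Metric Set Real MeasureTheory Filter Topology

/-! The energy `‖f‖^p_{α,p}` is compared with a harmonic model for which invariance is a reproducing
formula. Let `f` be analytic across the unit circle and zero-free on it. Hardy's convexity theorem
(`convexOn_integralMean_exp`) justifies an integration by parts that turns the energy into
`meanFunctional α` of the means of `|f|^p`, which is linear in those means. By Laurent splitting and
reflection, `|f|^p` agrees on the circle with `Re H`, where `H` is analytic on a larger disc
(`exists_re_eq_norm_rpow`). The functional sends the means of `Re H` to `Re H(0)`, so the energy
equals `Re H(0)` plus a multiple of the area integral of `(Re H - |f|^p)(1 - |z|²)^(α-2)`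
(`meanFunctional_circleAverage_eq`).

Let `φ` be the disc involution for `w` and `J = |φ'|`. Then `|Tf|^p = (|f|^p ∘ φ) J^α`, and the
natural comparison function is `(Re H ∘ φ) J^α`. As `1 - |φ|² = J (1 - |z|²)`, a change of variables
leaves the area integral unchanged (`setIntegral_discInvolution`). The other term is again `Re
H(0)`: `J^α` is an analytic factor times the kernel `(1 - w z̄)^(-α)`, which reproduces values at
`w`, and `φ(w) = 0` (`meanFunctional_mul_kernel`, `meanFunctional_re_discInvolution`).

For general `f`, dilate by radii tending to `1` whose circles avoid the zeros of `f`. Dilation does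
not increase the energy, and the energy is lower semicontinuous under convergence of the means; both
rest on convexity in `log r`. So `T` does not increase the energy, and equality follows because `T`
applied twice preserves moduli. -/

/-! ### Subharmonicity of `|f|^p` and convexity of its means in `log r` -/

/-- Jensen's formula gives the sub-mean inequality for `log ‖f‖`, since the zeros contribute
nonnegatively; the tangent line bound `1 + x ≤ exp x` transfers it to the `p`-th power. -/
theorem norm_rpow_le_circleAverage {f : ℂ → ℂ} {c : ℂ} {R p : ℝ} (hp : 0 < p) (hR : R ≠ 0)
    (hf : AnalyticOnNhd ℂ f (closedBall c |R|)) :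
    ‖f c‖ ^ p ≤ circleAverage (fun z => ‖f z‖ ^ p) c R := by
  by_cases hfc : f c = 0
  · rw [hfc, norm_zero, zero_rpow hp.ne']
    exact circleAverage_nonneg_of_nonneg fun z _ => by positivity
  set K := ‖f c‖ ^ p with hK
  have hKpos : 0 < K := rpow_pos_of_pos (norm_pos_iff.2 hfc) p
  have hsph : AnalyticOnNhd ℂ f (sphere c |R|) := hf.mono sphere_subset_closedBall
  have hlogint : CircleIntegrable (fun z => log ‖f z‖) c R :=
    hsph.meromorphicOn.circleIntegrable_log_norm
  have hlog : log ‖f c‖ ≤ circleAverage (fun z => log ‖f z‖) c R := by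
    rw [hf.circleAverage_log_norm hR hfc]
    refine le_add_of_nonneg_left (finsum_nonneg fun u => ?_)
    by_cases hu : u ∈ closedBall c |R|
    · refine mul_nonneg ?_ ?_
      · exact_mod_cast (MeromorphicOn.AnalyticOnNhd.divisor_nonneg hf) u
      · by_cases hcu : u = c
        · simp [hcu]
        · rw [← log_abs]
          apply log_nonneg
          have h1 : 0 < ‖c - u‖ := norm_pos_iff.2 (sub_ne_zero.2 (Ne.symm hcu))
          rw [abs_mul, abs_of_pos (inv_pos.2 h1), ← div_eq_mul_inv, one_le_div h1]
          rwa [mem_closedBall, dist_eq_norm'] at hu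
    · simp [Function.locallyFinsuppWithin.apply_eq_zero_of_notMem _ hu]
  -- The tangent line of `s ↦ exp (p * s)` at `s = log ‖f c‖`, evaluated at `log ‖f z‖`.
  set h : ℂ → ℝ := fun z => K * (1 - p * log ‖f c‖) + (K * p) * log ‖f z‖ with hh
  have hint : CircleIntegrable h c R :=
    (circleIntegrable_const _ _ _).add (hlogint.const_smul (a := K * p))
  have hhavg : K ≤ circleAverage h c R := by
    have e : circleAverage h c R = K * (1 - p * log ‖f c‖)
        + (K * p) * circleAverage (fun z => log ‖f z‖) c R := by
      refine (circleAverage_add (circleIntegrable_const (K * (1 - p * log ‖f c‖)) c R)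
        (hlogint.const_smul (a := K * p))).trans ?_
      rw [circleAverage_const]
      congr 1
      exact circleAverage_fun_smul (a := K * p) (f := fun z => log ‖f z‖)
    rw [e]
    nlinarith [mul_le_mul_of_nonneg_left hlog (mul_pos hKpos hp).le]
  have hcod : f ⁻¹' {0}ᶜ ∈ codiscreteWithin (sphere c |R|) := by
    have := hf.preimage_zero_mem_codiscreteWithin hfc (by simp)
      ((convex_closedBall c |R|).isConnected ⟨c, by simp⟩)
    exact codiscreteWithin_mono sphere_subset_closedBall this
  classical
  -- At a zero of `f` the convention `log 0 = 0` could make `h` exceed `‖f z‖ ^ p = 0`. The zeros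
  -- are negligible on the circle, so `h` is reset to `0` there.
  set h' : ℂ → ℝ := fun z => if f z = 0 then 0 else h z with hh'
  have hEq : h =ᶠ[codiscreteWithin (sphere c |R|)] h' := by
    filter_upwards [hcod] with z hz
    have : f z ≠ 0 := hz
    simp [hh', this]
  have hint' : CircleIntegrable h' c R := hint.congr_codiscreteWithin hEq
  calc K ≤ circleAverage h c R := hhavg
    _ = circleAverage h' c R := circleAverage_congr_codiscreteWithin hEq hR
    _ ≤ circleAverage (fun z => ‖f z‖ ^ p) c R := by
      refine circleAverage_mono hint' ?_ fun z hz => ?_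
      · refine ContinuousOn.circleIntegrable' ?_
        exact hsph.continuousOn.norm.rpow_const fun z _ => Or.inr hp.le
      · by_cases hz0 : f z = 0
        · simp [hh', hz0, zero_rpow hp.ne']
        · simp only [hh', hz0, if_false, hh]
          have e1 : ‖f z‖ ^ p = K * exp (p * log ‖f z‖ - p * log ‖f c‖) := by
            rw [exp_sub, mul_comm p, mul_comm p, ← rpow_def_of_pos (norm_pos_iff.2 hz0),
              ← rpow_def_of_pos (norm_pos_iff.2 hfc), ← hK]
            field_simp
          rw [e1]
          nlinarith [add_one_le_exp (p * log ‖f z‖ - p * log ‖f c‖)]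

/-- Averaging over rotations of `z` allows Fubini to exchange this mean with the average over
another circle. -/
theorem circleAverage_zero_norm {E : Type*} [NormedAddCommGroup E] [NormedSpace ℝ E]
    (u : ℂ → E) (z : ℂ) :
    circleAverage u 0 ‖z‖ =
      (2 * π)⁻¹ • ∫ θ in 0..2 * π, u (Complex.exp (θ * Complex.I) * z) := by
  rw [circleAverage_eq_integral_add z.arg]
  congr 1
  refine intervalIntegral.integral_congr fun θ _ => ?_
  simp only [circleMap, zero_add]
  congr 1
  push_cast
  rw [add_mul, Complex.exp_add]
  conv_rhs => rw [← Complex.norm_mul_exp_arg_mul_I z]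
  ring

/-- Maximum principle against the harmonic functions `a + b log ‖ζ‖`. If the bound fails, adding a
small `ε ‖ζ‖²` still leaves an interior maximum of the difference; there the average of `‖ζ‖²`
exceeds its central value by `ρ²`, contradicting the sub-mean inequality. -/
theorem le_add_mul_log_of_le_circleAverage {A : ℝ → ℝ} {r₁ r₂ a b : ℝ} (hr₁ : 0 < r₁)
    (hA : ContinuousOn A (Icc r₁ r₂))
    (hsub : ∀ x ∈ Ioo r₁ r₂, ∀ ρ > 0, r₁ ≤ x - ρ → x + ρ ≤ r₂ →
      A x ≤ circleAverage (fun ζ => A ‖ζ‖) x ρ)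
    (h₁ : A r₁ ≤ a + b * log r₁) (h₂ : A r₂ ≤ a + b * log r₂) {r : ℝ} (hr : r ∈ Icc r₁ r₂) :
    A r ≤ a + b * log r := by
  by_contra! hcon
  have hr₂ : 0 < r₂ := hr₁.trans_le (hr.1.trans hr.2)
  -- With this `ε`, the perturbation is at most half of the violation at `r`, so neither endpoint
  -- can carry the maximum.
  set ε := (A r - (a + b * log r)) / (2 * r₂ ^ 2) with hε
  have hε0 : 0 < ε := by
    apply div_pos (by linarith); positivity
  have hεr : ε * r₂ ^ 2 = (A r - (a + b * log r)) / 2 := by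
    rw [hε]; field_simp
  set W : ℝ → ℝ := fun x => A x - (a + b * log x) + ε * x ^ 2 with hW
  have hWc : ContinuousOn W (Icc r₁ r₂) := by
    refine (hA.sub (continuousOn_const.add (continuousOn_const.mul ?_))).add (by fun_prop)
    exact continuousOn_log.mono fun x hx => (hr₁.trans_le hx.1).ne'
  obtain ⟨x, hx, hmax⟩ := isCompact_Icc.exists_isMaxOn ⟨r, hr⟩ hWc
  have hWr : A r - (a + b * log r) ≤ W x := by
    refine le_trans ?_ (hmax hr)
    simp only [hW]
    nlinarith [sq_nonneg r]
  have hx1 : r₁ < x := by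
    refine lt_of_le_of_ne hx.1 fun h => ?_
    have : W x ≤ ε * r₂ ^ 2 := by
      simp only [hW, ← h]
      have : r₁ ^ 2 ≤ r₂ ^ 2 := pow_le_pow_left₀ hr₁.le (hr.1.trans hr.2) 2
      nlinarith
    linarith
  have hx2 : x < r₂ := by
    refine lt_of_le_of_ne hx.2 fun h => ?_
    have : W x ≤ ε * r₂ ^ 2 := by
      simp only [hW, h]
      linarith
    linarith
  set ρ := min (x - r₁) (r₂ - x) with hρ
  have hρ0 : 0 < ρ := lt_min (by linarith) (by linarith)
  have hρ1 : r₁ ≤ x - ρ := by linarith [min_le_left (x - r₁) (r₂ - x)]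
  have hρ2 : x + ρ ≤ r₂ := by linarith [min_le_right (x - r₁) (r₂ - x)]
  have hmem : ∀ ζ ∈ closedBall (x : ℂ) |ρ|, ‖ζ‖ ∈ Icc r₁ r₂ := by
    intro ζ hζ
    rw [mem_closedBall, dist_eq_norm, abs_of_pos hρ0] at hζ
    have hxn : ‖(x : ℂ)‖ = x := by
      rw [Complex.norm_real, norm_of_nonneg (hr₁.trans hx1).le]
    constructor
    · have := norm_sub_norm_le (x : ℂ) ζ
      rw [norm_sub_rev] at hζ
      linarith
    · have := norm_sub_norm_le ζ (x : ℂ)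
      linarith
  have hsph : ∀ ζ ∈ sphere (x : ℂ) |ρ|, ‖ζ‖ ∈ Icc r₁ r₂ := fun ζ hζ =>
    hmem ζ (sphere_subset_closedBall hζ)
  have hAi : CircleIntegrable (fun ζ : ℂ => A ‖ζ‖) x ρ :=
    (hA.comp continuous_norm.continuousOn hsph).circleIntegrable'
  have hlogavg : circleAverage (fun ζ : ℂ => log ‖ζ‖) x ρ = log x := by
    have := AnalyticOnNhd.circleAverage_log_norm_of_ne_zero (g := fun z => z) (c := (x : ℂ))
      (R := ρ) analyticOnNhd_id
      (fun u hu h0 => by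
        have := (hmem u hu).1
        rw [show u = 0 from h0, norm_zero] at this
        linarith)
    rw [this, Complex.norm_real, norm_of_nonneg (hr₁.trans hx1).le]
  have hlogi : CircleIntegrable (fun ζ : ℂ => log ‖ζ‖) x ρ := by
    refine ContinuousOn.circleIntegrable' (continuous_norm.continuousOn.log fun ζ hζ => ?_)
    exact (hr₁.trans_le (hsph ζ hζ).1).ne'
  have hsqi : CircleIntegrable (fun ζ : ℂ => ‖ζ‖ ^ 2) x ρ :=
    ContinuousOn.circleIntegrable' (by fun_prop)
  have hsqavg : circleAverage (fun ζ : ℂ => ‖ζ‖ ^ 2) x ρ = x ^ 2 + ρ ^ 2 := by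
    have e : ∀ θ : ℝ, ‖circleMap (x : ℂ) ρ θ‖ ^ 2 = (x ^ 2 + ρ ^ 2) + (2 * x * ρ) * cos θ := by
      intro θ
      rw [← Complex.normSq_eq_norm_sq, Complex.normSq_apply]
      simp only [circleMap, Complex.add_re, Complex.add_im, Complex.mul_re, Complex.mul_im,
        Complex.ofReal_re, Complex.ofReal_im, Complex.exp_ofReal_mul_I_re,
        Complex.exp_ofReal_mul_I_im]
      nlinarith [sin_sq_add_cos_sq θ]
    rw [circleAverage_def]
    simp only [e]
    rw [intervalIntegral.integral_add (by simp) (by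
      apply Continuous.intervalIntegrable; fun_prop)]
    simp
    field_simp
  have key : circleAverage (fun ζ : ℂ => A ‖ζ‖) x ρ ≤
      W x + (a + b * log x) - ε * (x ^ 2 + ρ ^ 2) := by
    have hle : ∀ ζ ∈ sphere (x : ℂ) |ρ|, A ‖ζ‖ ≤
        (W x + a) + (b • log ‖ζ‖ + (-ε) • ‖ζ‖ ^ 2) := by
      intro ζ hζ
      have : W ‖ζ‖ ≤ W x := hmax (hsph ζ hζ)
      simp only [hW, smul_eq_mul] at this ⊢
      linarith
    have hb := hlogi.const_smul (a := b)
    have hc := hsqi.const_smul (a := -ε)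
    refine (circleAverage_mono hAi ((circleIntegrable_const _ _ _).add (hb.add hc)) hle).trans_eq ?_
    have e1 := circleAverage_add (circleIntegrable_const (W x + a) (x : ℂ) ρ) (hb.add hc)
    rw [e1, circleAverage_add hb hc, circleAverage_smul, circleAverage_smul, circleAverage_const]
    have e2 : circleAverage (fun ζ : ℂ => log ‖ζ‖) x ρ = log x := hlogavg
    rw [e2, hsqavg]
    simp only [smul_eq_mul]
    ring
  have := hsub x ⟨hx1, hx2⟩ ρ hρ0 hρ1 hρ2
  have e : W x = A x - (a + b * log x) + ε * x ^ 2 := rfl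
  have : 0 < ε * ρ ^ 2 := by positivity
  nlinarith

theorem continuousOn_norm_rpow {f : ℂ → ℂ} {s : Set ℂ} {p : ℝ} (hp : 0 < p)
    (hf : ContinuousOn f s) : ContinuousOn (fun z => ‖f z‖ ^ p) s :=
  hf.norm.rpow_const fun _ _ => Or.inr hp.le

/-- Every rotate of `f` satisfies the sub-mean inequality at `x`; average over the rotations and
apply Fubini. -/
theorem circleAverage_norm_le_circleAverage {f : ℂ → ℂ} {R p : ℝ} (hp : 0 < p)
    (hf : DifferentiableOn ℂ f (ball 0 R)) {x ρ : ℝ} (hx : 0 < x) (hρ : 0 < ρ)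
    (hxρ : x + ρ < R) :
    integralMean p f x ≤ circleAverage (fun ζ => integralMean p f ‖ζ‖) x ρ := by
  set u : ℂ → ℝ := fun z => ‖f z‖ ^ p with hu
  have hxn : ‖(x : ℂ)‖ = x := by rw [Complex.norm_real, norm_of_nonneg hx.le]
  have hball : ∀ θ : ℝ, ∀ z ∈ closedBall (x : ℂ) |ρ|, Complex.exp (θ * Complex.I) * z ∈ ball 0 R := by
    intro θ z hz
    rw [mem_closedBall, dist_eq_norm, abs_of_pos hρ] at hz
    rw [mem_ball_zero_iff, norm_mul, Complex.norm_exp_ofReal_mul_I, one_mul]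
    have := norm_sub_norm_le z (x : ℂ)
    linarith
  have huc : ContinuousOn u (ball 0 R) := continuousOn_norm_rpow hp hf.continuousOn
  have hcont : Continuous (fun q : ℝ × ℝ =>
      u (Complex.exp (q.1 * Complex.I) * circleMap x ρ q.2)) := by
    refine huc.comp_continuous (by fun_prop) fun q => hball q.1 _ ?_
    exact sphere_subset_closedBall (circleMap_mem_sphere' _ _ _)
  have h1 : ∀ θ : ℝ, u (Complex.exp (θ * Complex.I) * x) ≤
      circleAverage (fun z => u (Complex.exp (θ * Complex.I) * z)) x ρ := by
    intro θ
    refine norm_rpow_le_circleAverage (f := fun z => f (Complex.exp (θ * Complex.I) * z)) hp hρ.ne' ?_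
    intro z hz
    have h := hf.analyticAt (isOpen_ball.mem_nhds (hball θ z hz))
    exact h.comp_of_eq (by fun_prop) rfl
  have e1 : integralMean p f x =
      (2 * π)⁻¹ * ∫ θ in 0..2 * π, u (Complex.exp (θ * Complex.I) * x) := by
    have := circleAverage_zero_norm u x
    rwa [hxn, smul_eq_mul] at this
  have e2 : circleAverage (fun ζ => integralMean p f ‖ζ‖) x ρ =
      (2 * π)⁻¹ * ∫ θ in 0..2 * π,
        circleAverage (fun z => u (Complex.exp (θ * Complex.I) * z)) x ρ := by
    simp only [integralMean, circleAverage_zero_norm]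
    simp only [circleAverage_def, smul_eq_mul, intervalIntegral.integral_const_mul]
    congr 2
    simp only [intervalIntegral.integral_of_le two_pi_pos.le]
    refine integral_integral_swap
      (μ := volume.restrict (Ioc 0 (2 * π))) (ν := volume.restrict (Ioc 0 (2 * π)))
      (f := fun θ' θ : ℝ => u (Complex.exp (θ * Complex.I) * circleMap x ρ θ')) ?_
    rw [Measure.prod_restrict, ← IntegrableOn]
    exact ((hcont.comp continuous_swap).continuousOn.integrableOn_compact
      (isCompact_Icc.prod isCompact_Icc)).mono_set
        (prod_mono Ioc_subset_Icc_self Ioc_subset_Icc_self)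
  rw [e1, e2]
  refine mul_le_mul_of_nonneg_left ?_ (by positivity)
  refine intervalIntegral.integral_mono_on two_pi_pos.le ?_ ?_ fun θ _ => h1 θ
  · refine Continuous.intervalIntegrable ?_ _ _
    refine huc.comp_continuous (by fun_prop) fun q => hball q _ (by simp)
  · refine Continuous.intervalIntegrable ?_ _ _
    exact (intervalIntegral.continuous_parametric_intervalIntegral_of_continuous'
      (f := fun θ θ' : ℝ => u (Complex.exp (θ * Complex.I) * circleMap x ρ θ')) hcont _ _).const_smul
      (2 * π)⁻¹

theorem continuousOn_integralMean {f : ℂ → ℂ} {R p : ℝ} (hp : 0 < p)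
    (hf : ContinuousOn f (ball 0 R)) : ContinuousOn (integralMean p f) (Ico 0 R) := by
  refine ContinuousOn.circleAverage ?_ fun r hr => hr.1
  refine (continuousOn_norm_rpow hp hf).mono fun z hz => ?_
  have : ‖z - 0‖ ∈ Ico 0 R := hz
  rw [sub_zero] at this
  simpa using this.2

/-- Hardy's convexity theorem. -/
theorem convexOn_integralMean_exp {f : ℂ → ℂ} {R p : ℝ} (hp : 0 < p) (hR : 0 < R)
    (hf : DifferentiableOn ℂ f (ball 0 R)) :
    ConvexOn ℝ (Iio (log R)) (fun t => integralMean p f (exp t)) := by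
  refine LinearOrder.convexOn_of_lt (convex_Iio _) fun s hs t ht hst a b ha hb hab => ?_
  set A := integralMean p f
  have htR : exp t < R := by
    rw [← exp_log hR]; exact exp_lt_exp.2 ht
  have hts : 0 < t - s := by linarith
  set m := (A (exp t) - A (exp s)) / (t - s) with hm
  have hmt : m * (t - s) = A (exp t) - A (exp s) := by rw [hm]; field_simp
  have hx : a • s + b • t ∈ Icc s t := by
    simp only [smul_eq_mul, mem_Icc]
    have : a = 1 - b := by linarith
    subst this
    constructor <;> nlinarith
  have := le_add_mul_log_of_le_circleAverage (A := A) (r₁ := exp s) (r₂ := exp t)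
    (a := A (exp s) - m * s) (b := m) (exp_pos s)
    ((continuousOn_integralMean hp hf.continuousOn).mono fun x hx =>
      ⟨(exp_pos s).le.trans hx.1, hx.2.trans_lt htR⟩)
    (fun x hx ρ hρ _ hρ2 => circleAverage_norm_le_circleAverage hp hf ((exp_pos s).trans hx.1) hρ
      (hρ2.trans_lt htR))
    (by rw [log_exp]; linarith) (by rw [log_exp]; linarith)
    (r := exp (a • s + b • t)) ⟨exp_le_exp.2 hx.1, exp_le_exp.2 hx.2⟩
  refine this.trans_eq ?_
  rw [log_exp]
  simp only [smul_eq_mul]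
  have : a = 1 - b := by linarith
  subst this
  linear_combination b * hmt

/-- A convex function of `log r` that decreases somewhere lies above a line of negative slope
further left, hence tends to `+∞` as `r → 0`. Continuity of the mean at `0` forbids this. -/
theorem monotoneOn_integralMean {f : ℂ → ℂ} {R p : ℝ} (hp : 0 < p)
    (hf : DifferentiableOn ℂ f (ball 0 R)) : MonotoneOn (integralMean p f) (Ico 0 R) := by
  have hcont := continuousOn_integralMean hp hf.continuousOn
  set A := integralMean p f
  have main : ∀ s ∈ Ioo 0 R, ∀ t ∈ Ioo 0 R, s ≤ t → A s ≤ A t := by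
    intro s hs t ht hst
    rcases hst.eq_or_lt with rfl | hst
    · rfl
    have hR := hs.1.trans hs.2
    have hconv := convexOn_integralMean_exp hp hR hf
    by_contra! hlt
    have hls : log s < log t := log_lt_log hs.1 hst
    set m := (A s - A t) / (log t - log s) with hm
    have hm0 : 0 < m := div_pos (by linarith) (by linarith)
    have hlow : ∀ r ∈ Ioo 0 s, A s + m * (log s - log r) ≤ A r := by
      intro r hr
      have hlr : log r < log s := log_lt_log hr.1 hr.2
      have := hconv.slope_mono_adjacent (x := log r) (y := log s) (z := log t)
        (log_lt_log hr.1 (hr.2.trans hs.2)) (log_lt_log ht.1 ht.2) hlr hls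
      simp only [exp_log hr.1, exp_log hs.1, exp_log ht.1] at this
      have h2 : (A t - A s) / (log t - log s) = -m := by rw [hm, ← neg_div, neg_sub]
      change (A s - A r) / _ ≤ (A t - A s) / _ at this
      rw [h2, div_le_iff₀ (by linarith)] at this
      linarith
    have h0 : Tendsto A (𝓝[>] 0) (𝓝 (A 0)) :=
      ((hcont 0 ⟨le_rfl, hR⟩).tendsto).mono_left (nhdsWithin_le_iff.2
        (mem_of_superset (Ioo_mem_nhdsGT hR) Ioo_subset_Ico_self))
    have h1 : Tendsto (fun r => A s + m * (log s - log r)) (𝓝[>] 0) atTop := by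
      refine tendsto_atTop_add_const_left _ _ (Tendsto.const_mul_atTop hm0 ?_)
      simp only [sub_eq_add_neg]
      exact tendsto_atTop_add_const_left _ _
        (tendsto_neg_atBot_atTop.comp tendsto_log_nhdsGT_zero)
    have h2 : Tendsto A (𝓝[>] 0) atTop := by
      refine tendsto_atTop_mono' _ ?_ h1
      filter_upwards [Ioo_mem_nhdsGT hs.1] with r hr using hlow r hr
    exact not_tendsto_nhds_of_tendsto_atTop h2 _ h0
  intro s hs t ht hst
  rcases hs.1.eq_or_lt with h | h
  · rcases hst.eq_or_lt with rfl | hst'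
    · rfl
    subst h
    refine le_of_tendsto (f := A) (x := 𝓝[>] 0) (((hcont 0 hs).tendsto).mono_left
      (nhdsWithin_le_iff.2 (mem_of_superset (Ioo_mem_nhdsGT hs.2) Ioo_subset_Ico_self))) ?_
    filter_upwards [Ioo_mem_nhdsGT hst'] with r hr
    exact main r ⟨hr.1, hr.2.trans ht.2⟩ t ⟨hst', ht.2⟩ hr.2.le
  · exact main s ⟨h, hs.2⟩ t ⟨h.trans_le hst, ht.2⟩ hst

/-! ### The energy after integration by parts -/

/-- For a Lipschitz function `m` this is `m 0 + ∫_0^1 m'(r) (1 - r^2)^(α-1) dr`, integrated by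
parts. -/
noncomputable def meanFunctional (α : ℝ) (m : ℝ → ℝ) : ℝ :=
  m 1 + 2 * (1 - α) * ∫ ρ in (0 : ℝ)..1, (m 1 - m ρ) * (ρ * (1 - ρ ^ 2) ^ (α - 2))

theorem one_sub_sq_pos {r : ℝ} (h : r ∈ Ioo (0 : ℝ) 1) : 0 < 1 - r ^ 2 := by
  nlinarith [h.1, h.2]

theorem hasDerivAt_one_sub_sq_rpow (β : ℝ) {r : ℝ} (h : r ∈ Ioo (0 : ℝ) 1) :
    HasDerivAt (fun r : ℝ => (1 - r ^ 2) ^ β) (-(2 * β) * (r * (1 - r ^ 2) ^ (β - 1))) r := by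
  have h1 : HasDerivAt (fun r : ℝ => 1 - r ^ 2) (-(2 * r)) r := by
    simpa using (hasDerivAt_pow 2 r).const_sub 1
  convert h1.rpow_const (p := β) (Or.inl (one_sub_sq_pos h).ne') using 1
  ring

theorem intervalIntegrable_mul_one_sub_sq_rpow {α : ℝ} (hα : 0 < α) :
    IntervalIntegrable (fun ρ : ℝ => ρ * (1 - ρ ^ 2) ^ (α - 1)) volume 0 1 := by
  rw [intervalIntegrable_iff_integrableOn_Ioc_of_le zero_le_one]
  refine intervalIntegral.integrableOn_deriv_of_nonneg
    (g := fun ρ : ℝ => -(2 * α)⁻¹ * (1 - ρ ^ 2) ^ α) ?_ (fun x hx => ?_) fun x hx => ?_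
  · refine continuousOn_const.mul (ContinuousOn.rpow_const (by fun_prop) fun _ _ => Or.inr hα.le)
  · refine ((hasDerivAt_one_sub_sq_rpow α hx).const_mul (-(2 * α)⁻¹)).congr_deriv ?_
    rw [← mul_assoc, neg_mul_neg, inv_mul_cancel₀ (by positivity), one_mul]
  · exact mul_nonneg hx.1.le (rpow_nonneg (one_sub_sq_pos hx).le _)

theorem one_sub_mul_rpow_le {α ρ : ℝ} (h : ρ ∈ Ioo (0 : ℝ) 1) :
    (1 - ρ) * (ρ * (1 - ρ ^ 2) ^ (α - 2)) ≤ ρ * (1 - ρ ^ 2) ^ (α - 1) := by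
  have h0 := one_sub_sq_pos h
  have e : (1 - ρ ^ 2) ^ (α - 1) = (1 - ρ ^ 2) * (1 - ρ ^ 2) ^ (α - 2) := by
    rw [show α - 2 = α - 1 - 1 by ring, rpow_sub_one h0.ne' (α - 1)]
    field_simp
  rw [e]
  have h2 : 0 ≤ ρ * (1 - ρ ^ 2) ^ (α - 2) := mul_nonneg h.1.le (rpow_nonneg h0.le _)
  nlinarith [h.1, h.2, mul_nonneg h2 (mul_nonneg h.1.le (sub_nonneg.2 h.2.le))]

/-- Linear vanishing at `1` raises the exponent `α - 2` to `α - 1`, which is integrable for every `α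
> 0`. -/
theorem intervalIntegrable_mul_mul_one_sub_sq_rpow {α C : ℝ} (hα : 0 < α) {g : ℝ → ℝ}
    (hg : ContinuousOn g (Ioo 0 1)) (hC : ∀ ρ ∈ Ioo (0 : ℝ) 1, |g ρ| ≤ C * (1 - ρ)) :
    IntervalIntegrable (fun ρ : ℝ => g ρ * (ρ * (1 - ρ ^ 2) ^ (α - 2))) volume 0 1 := by
  have h := (intervalIntegrable_mul_one_sub_sq_rpow hα).const_mul C
  rw [intervalIntegrable_iff_integrableOn_Ioo_of_le zero_le_one] at h ⊢
  refine h.mono' (ContinuousOn.aestronglyMeasurable ?_ measurableSet_Ioo) ?_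
  · refine hg.mul (continuousOn_id.mul (ContinuousOn.rpow_const (by fun_prop) fun x hx => ?_))
    exact Or.inl (one_sub_sq_pos hx).ne'
  · refine (ae_restrict_iff' measurableSet_Ioo).2 (Eventually.of_forall fun ρ hρ => ?_)
    have h2 : 0 ≤ ρ * (1 - ρ ^ 2) ^ (α - 2) :=
      mul_nonneg hρ.1.le (rpow_nonneg (one_sub_sq_pos hρ).le _)
    have hC0 : 0 ≤ C := by
      have := (abs_nonneg _).trans (hC ρ hρ)
      exact nonneg_of_mul_nonneg_left this (by linarith [hρ.2])
    rw [norm_mul, norm_eq_abs, norm_of_nonneg h2]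
    calc |g ρ| * (ρ * (1 - ρ ^ 2) ^ (α - 2))
        ≤ C * (1 - ρ) * (ρ * (1 - ρ ^ 2) ^ (α - 2)) := by gcongr; exact hC ρ hρ
      _ = C * ((1 - ρ) * (ρ * (1 - ρ ^ 2) ^ (α - 2))) := by ring
      _ ≤ _ := mul_le_mul_of_nonneg_left (one_sub_mul_rpow_le hρ) hC0

/-- Convexity beyond `t = 0`, available because `T > 0`, bounds the slopes to the left of `0` by the
slope `K` over `[0, T/2]`. For `ρ < 1/2` the factor `1 - ρ` is bounded below and monotonicity
suffices. -/
theorem exists_one_sub_le_of_convexOn {m : ℝ → ℝ} {T : ℝ} (hT : 0 < T)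
    (hmono : MonotoneOn m (Icc 0 1)) (hconv : ConvexOn ℝ (Iio T) (fun t => m (exp t))) :
    ∃ C, ∀ ρ ∈ Icc (0 : ℝ) 1, |m 1 - m ρ| ≤ C * (1 - ρ) := by
  set K := (m (exp (T / 2)) - m 1) / (T / 2) with hK
  refine ⟨max (2 * (m 1 - m 0)) (2 * K), fun ρ hρ => ?_⟩
  have hle : m ρ ≤ m 1 := hmono hρ ⟨zero_le_one, le_rfl⟩ hρ.2
  rw [abs_of_nonneg (sub_nonneg.2 hle)]
  rcases hρ.2.eq_or_lt with rfl | h1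
  · simp
  rcases lt_or_ge ρ (1 / 2) with h | h
  · have h0 : m 0 ≤ m ρ := hmono ⟨le_rfl, zero_le_one⟩ hρ hρ.1
    have h01 : m 0 ≤ m 1 := h0.trans hle
    calc m 1 - m ρ ≤ (2 * (m 1 - m 0)) * (1 - ρ) := by nlinarith
      _ ≤ _ := by gcongr; exact le_max_left _ _
  · have h0 : 0 < ρ := by linarith
    have hl : log ρ < 0 := log_neg h0 h1
    have hs := hconv.slope_mono_adjacent (x := log ρ) (y := 0) (z := T / 2)
      (show log ρ < T by linarith) (show T / 2 < T by linarith) hl (by linarith)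
    simp only [exp_log h0, exp_zero, sub_zero, zero_sub, ← hK] at hs
    rw [div_le_iff₀ (by linarith)] at hs
    have hK0 : 0 ≤ K := by
      by_contra! hneg
      nlinarith
    have hlog : -log ρ ≤ 2 * (1 - ρ) := by
      have := one_sub_inv_le_log_of_pos h0
      have h3 : ρ⁻¹ - 1 ≤ 2 * (1 - ρ) := by
        rw [inv_eq_one_div, div_sub' h0.ne', div_le_iff₀ h0]
        nlinarith
      linarith
    calc m 1 - m ρ ≤ K * -log ρ := hs
      _ ≤ K * (2 * (1 - ρ)) := by gcongr
      _ = 2 * K * (1 - ρ) := by ring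
      _ ≤ _ := by gcongr; exact le_max_right _ _

/-- Convexity supplies right derivatives everywhere, while the norm uses the two-sided `deriv`. By
Lebesgue's theorem on monotone functions they differ only on a null set. -/
theorem ae_deriv_eq_of_monotoneOn {m m' : ℝ → ℝ} (hmono : MonotoneOn m (Ioo 0 1))
    (hm' : ∀ r ∈ Ioo (0 : ℝ) 1, HasDerivWithinAt m (m' r) (Ioi r) r) :
    ∀ᵐ r ∂(volume.restrict (Ioo (0 : ℝ) 1)), deriv m r = m' r := by
  filter_upwards [hmono.ae_differentiableWithinAt measurableSet_Ioo,
    ae_restrict_mem measurableSet_Ioo] with r hr hmem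
  have h := (hr.differentiableAt (isOpen_Ioo.mem_nhds hmem)).hasDerivAt
  exact (uniqueDiffWithinAt_Ioi r).eq_deriv _ h.hasDerivWithinAt (hm' r hmem)

theorem lintegral_deriv_mul_rpow {α T : ℝ} (hα : 0 < α) (hT : 0 < T) {m : ℝ → ℝ}
    (hcont : ContinuousOn m (Icc 0 1)) (hmono : MonotoneOn m (Icc 0 1))
    (hconv : ConvexOn ℝ (Iio T) (fun t => m (exp t))) :
    ∫⁻ r in Ioo (0 : ℝ) 1, ENNReal.ofReal (deriv m r * (1 - r ^ 2) ^ (α - 1)) =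
      ENNReal.ofReal (meanFunctional α m - m 0) ∧ m 0 ≤ meanFunctional α m := by
  obtain ⟨C, hC⟩ := exists_one_sub_le_of_convexOn hT hmono hconv
  set m' : ℝ → ℝ := fun r => derivWithin (fun t => m (exp t)) (Ioi (log r)) (log r) * r⁻¹ with hm'
  have hm'd : ∀ r ∈ Ioo (0 : ℝ) 1, HasDerivWithinAt m (m' r) (Ioi r) r := by
    intro r hr
    have hint : log r ∈ interior (Iio T) := by
      rw [interior_Iio]
      exact (log_neg hr.1 hr.2).trans hT
    have h := (hconv.hasDerivWithinAt_rightDeriv_of_mem_interior hint).comp r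
      (hasDerivAt_log hr.1.ne').hasDerivWithinAt
      (fun x hx => log_lt_log hr.1 hx)
    refine h.congr_of_eventuallyEq ?_ ?_
    · filter_upwards [self_mem_nhdsWithin] with x hx
      simp [exp_log (hr.1.trans hx)]
    · simp [exp_log hr.1]
  have hm'0 : ∀ r ∈ Ioo (0 : ℝ) 1, 0 ≤ m' r := by
    intro r hr
    refine ge_of_tendsto (hasDerivWithinAt_iff_tendsto_slope' (self_notMem_Ioi)|>.1 (hm'd r hr)) ?_
    filter_upwards [Ioo_mem_nhdsGT hr.2] with x hx
    rw [slope_def_field]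
    exact div_nonneg (sub_nonneg.2 (hmono ⟨hr.1.le, hr.2.le⟩
      ⟨(hr.1.trans hx.1).le, hx.2.le⟩ hx.1.le)) (sub_nonneg.2 hx.1.le)
  set k : ℝ → ℝ := fun ρ => (m 1 - m ρ) * (ρ * (1 - ρ ^ 2) ^ (α - 2)) with hk
  have hki : IntervalIntegrable k volume 0 1 :=
    intervalIntegrable_mul_mul_one_sub_sq_rpow hα
      (continuousOn_const.sub (hcont.mono Ioo_subset_Icc_self))
      fun ρ hρ => hC ρ (Ioo_subset_Icc_self hρ)
  have hkc : ContinuousOn k (Ioo 0 1) := by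
    refine (continuousOn_const.sub (hcont.mono Ioo_subset_Icc_self)).mul
      (continuousOn_id.mul (ContinuousOn.rpow_const (by fun_prop) fun x hx => ?_))
    exact Or.inl (one_sub_sq_pos hx).ne'
  -- A primitive of `m' r * (1 - r ^ 2) ^ (α - 1)`. Integrating by parts with `m r - m 1` instead of
  -- `m r` makes the boundary term vanish at `1`, even for `α < 1`.
  set Φ : ℝ → ℝ := fun r => (m r - m 1) * (1 - r ^ 2) ^ (α - 1) +
    2 * (1 - α) * ∫ ρ in (0 : ℝ)..r, k ρ with hΦ
  have hΦd : ∀ r ∈ Ioo (0 : ℝ) 1,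
      HasDerivWithinAt Φ (m' r * (1 - r ^ 2) ^ (α - 1)) (Ioi r) r := by
    intro r hr
    have h1 := ((hm'd r hr).sub_const (m 1)).mul
      (hasDerivAt_one_sub_sq_rpow (α - 1) hr).hasDerivWithinAt
    have h2 : HasDerivAt (fun r => ∫ ρ in (0 : ℝ)..r, k ρ) (k r) r := by
      refine intervalIntegral.integral_hasDerivAt_right
        (hki.mono_set (uIcc_subset_uIcc left_mem_uIcc ?_))
        (hkc.stronglyMeasurableAtFilter isOpen_Ioo r hr) (hkc.continuousAt (isOpen_Ioo.mem_nhds hr))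
      rw [uIcc_of_le zero_le_one]; exact ⟨hr.1.le, hr.2.le⟩
    refine (h1.add (h2.hasDerivWithinAt.const_mul (2 * (1 - α)))).congr_deriv ?_
    simp only [hk]
    rw [show α - 1 - 1 = α - 2 by ring]
    ring
  have hΦc : ContinuousOn Φ (Icc 0 1) := by
    refine ContinuousOn.add ?_ (continuousOn_const.mul ?_)
    · intro r hr
      rcases hr.2.eq_or_lt with rfl | h1
      -- The Lipschitz bound dominates the boundary term by `C * (1 - r ^ 2) ^ α`, which tends to
      -- `0`.
      · have h0 : Tendsto (fun r : ℝ => C * (1 - r ^ 2) ^ α) (𝓝[Icc 0 1] 1) (𝓝 0) := by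
          have : ContinuousAt (fun r : ℝ => C * (1 - r ^ 2) ^ α) 1 := by
            refine continuousAt_const.mul (ContinuousAt.rpow_const (by fun_prop) (Or.inr hα.le))
          have h := this.tendsto
          simp only [one_pow, sub_self, zero_rpow hα.ne', mul_zero] at h
          exact h.mono_left nhdsWithin_le_nhds
        rw [ContinuousWithinAt, sub_self, zero_mul]
        refine squeeze_zero_norm' ?_ h0
        filter_upwards [self_mem_nhdsWithin] with r hr
        rcases hr.2.eq_or_lt with rfl | h1
        · simp [zero_rpow hα.ne']
        have hd : 0 < 1 - r ^ 2 := by nlinarith [hr.1]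
        rw [norm_mul, norm_eq_abs, abs_sub_comm, norm_of_nonneg (rpow_nonneg hd.le _)]
        have e : (1 - r ^ 2) ^ α = (1 - r ^ 2) * (1 - r ^ 2) ^ (α - 1) := by
          rw [rpow_sub_one hd.ne']; field_simp
        rw [e, ← mul_assoc]
        refine mul_le_mul_of_nonneg_right ((hC r hr).trans ?_) (rpow_nonneg hd.le _)
        have hC0 : 0 ≤ C := by
          have := (abs_nonneg _).trans (hC 0 ⟨le_rfl, zero_le_one⟩)
          simpa using this
        nlinarith [mul_nonneg hC0 (mul_nonneg hr.1 (sub_nonneg.2 hr.2))]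
      · refine ((hcont r hr).sub continuousWithinAt_const).mul (ContinuousWithinAt.rpow_const
          (by fun_prop) (Or.inl ?_))
        have : 0 < 1 - r ^ 2 := by nlinarith [hr.1]
        exact this.ne'
    · have := intervalIntegral.continuousOn_primitive_interval' hki left_mem_uIcc
      rwa [uIcc_of_le zero_le_one] at this
  have hnn : ∀ r ∈ Ioo (0 : ℝ) 1, 0 ≤ m' r * (1 - r ^ 2) ^ (α - 1) := fun r hr =>
    mul_nonneg (hm'0 r hr) (rpow_nonneg (one_sub_sq_pos hr).le _)
  have hint := intervalIntegral.integrableOn_deriv_right_of_nonneg hΦc hΦd hnn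
  have hval := intervalIntegral.integral_eq_sub_of_hasDeriv_right_of_le zero_le_one hΦc hΦd
    ((intervalIntegrable_iff_integrableOn_Ioc_of_le zero_le_one).2 hint)
  have hend : Φ 1 - Φ 0 = meanFunctional α m - m 0 := by
    simp only [hΦ, meanFunctional, hk]
    simp
    ring
  refine ⟨?_, ?_⟩
  swap
  · rw [← sub_nonneg, ← hend, ← hval, intervalIntegral.integral_of_le zero_le_one,
      integral_Ioc_eq_integral_Ioo]
    exact setIntegral_nonneg measurableSet_Ioo hnn
  rw [← hend, ← hval, intervalIntegral.integral_of_le zero_le_one, integral_Ioc_eq_integral_Ioo,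
    ofReal_integral_eq_lintegral_ofReal (hint.mono_set Ioo_subset_Ioc_self)
      ((ae_restrict_iff' measurableSet_Ioo).2 (Eventually.of_forall hnn))]
  refine lintegral_congr_ae ?_
  filter_upwards [ae_deriv_eq_of_monotoneOn (hmono.mono Ioo_subset_Icc_self) hm'd] with r hr
  rw [hr]

theorem dirichletNorm_eq_meanFunctional {α p R : ℝ} (hα : 0 < α) (hp : 0 < p) (hR : 1 < R)
    {f : ℂ → ℂ} (hf : DifferentiableOn ℂ f (ball 0 R)) :
    dirichletNorm α p f = (ENNReal.ofReal (meanFunctional α (integralMean p f))) ^ (1 / p) := by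
  have hsub : Icc (0 : ℝ) 1 ⊆ Ico 0 R := fun x hx => ⟨hx.1, hx.2.trans_lt hR⟩
  have h0 : integralMean p f 0 = ‖f 0‖ ^ p := circleAverage_zero
  obtain ⟨h, hle⟩ := lintegral_deriv_mul_rpow (T := log R) hα (log_pos hR)
    ((continuousOn_integralMean hp hf.continuousOn).mono hsub)
    ((monotoneOn_integralMean hp hf).mono hsub)
    (convexOn_integralMean_exp hp (by linarith) hf)
  rw [h0] at h hle
  rw [dirichletNorm, h, ← ENNReal.ofReal_add (by positivity) (sub_nonneg.2 hle), add_sub_cancel]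

/-! ### `|f|^p` on the circle as the real part of an analytic function -/

theorem differentiableOn_circleAverage_cauchy {G : ℂ → ℂ} {S : ℝ} (hS : 0 < S)
    (hG : ContinuousOn G (sphere 0 S)) :
    DifferentiableOn ℂ (fun z => circleAverage (fun η => (η - z)⁻¹ * G η) 0 S) (ball 0 S) := by
  have hi : CircleIntegrable (fun η : ℂ => η⁻¹ * G η) 0 S := by
    refine ContinuousOn.circleIntegrable hS.le (ContinuousOn.mul ?_ hG)
    exact continuousOn_id.inv₀ fun z hz => ne_zero_of_mem_sphere hS.ne' ⟨z, hz⟩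
  lift S to NNReal using hS.le
  have h := (hasFPowerSeriesOn_cauchy_integral hi hS).differentiableOn
  rw [eball_coe] at h
  refine h.congr fun z _ => ?_
  rw [circleAverage_eq_circleIntegral hS.ne']
  congr 1
  refine circleIntegral.integral_congr hS.le fun η _ => ?_
  simp only [smul_eq_mul, sub_zero]
  ring

/-- The Laurent splitting of a function on an annulus, evaluated at a point of it. -/
theorem eq_circleAverage_sub_circleAverage {Q : ℂ → ℂ} {r s S R : ℝ} (hs0 : 0 < s) (hrs : r < s)
    (hSR : S < R) (hQ : DifferentiableOn ℂ Q {z | r < ‖z‖ ∧ ‖z‖ < R}) {z : ℂ}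
    (hsz : s < ‖z‖) (hzS : ‖z‖ < S) :
    Q z = circleAverage (fun ζ => (ζ - z)⁻¹ * (ζ * Q ζ)) 0 S -
      circleAverage (fun ζ => (ζ - z)⁻¹ * (ζ * Q ζ)) 0 s := by
  have hS0 : 0 < S := hs0.trans (hsz.trans hzS)
  have hopen : IsOpen {z : ℂ | r < ‖z‖ ∧ ‖z‖ < R} :=
    (isOpen_lt continuous_const continuous_norm).inter (isOpen_lt continuous_norm continuous_const)
  have hk : DifferentiableOn ℂ (dslope Q z) {z | r < ‖z‖ ∧ ‖z‖ < R} :=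
    (Complex.differentiableOn_dslope (hopen.mem_nhds ⟨hrs.trans hsz, hzS.trans hSR⟩)).2 hQ
  have hsub : closedBall (0 : ℂ) S \ ball 0 s ⊆ {z | r < ‖z‖ ∧ ‖z‖ < R} := by
    rintro ζ ⟨h1, h2⟩
    rw [mem_closedBall_zero_iff] at h1
    rw [mem_ball_zero_iff, not_lt] at h2
    exact ⟨hrs.trans_le h2, h1.trans_lt hSR⟩
  have hF : DifferentiableOn ℂ (fun ζ => ζ * dslope Q z ζ) {z | r < ‖z‖ ∧ ‖z‖ < R} :=
    differentiableOn_id.mul hk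
  -- `dslope Q z` has no singularity at `z`, so Cauchy's theorem on the annulus applies; the factor
  -- `ζ` cancels the `ζ⁻¹` in the contour form of the average.
  have hind : circleAverage (fun ζ => ζ * dslope Q z ζ) 0 S =
      circleAverage (fun ζ => ζ * dslope Q z ζ) 0 s := by
    rw [circleAverage_eq_circleIntegral hS0.ne', circleAverage_eq_circleIntegral hs0.ne']
    congr 1
    refine Complex.circleIntegral_sub_center_inv_smul_eq_of_differentiable_on_annulus_off_countable
      hs0 (hsz.trans hzS).le countable_empty (hF.continuousOn.mono hsub) fun ζ hζ => ?_
    refine hF.differentiableAt (hopen.mem_nhds (hsub ⟨ball_subset_closedBall hζ.1.1, fun h => ?_⟩))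
    exact hζ.1.2 (ball_subset_closedBall h)
  have havg : ∀ t, 0 < t → ‖z‖ ≠ t → sphere (0 : ℂ) t ⊆ {z | r < ‖z‖ ∧ ‖z‖ < R} →
      circleAverage (fun ζ => ζ * dslope Q z ζ) 0 t =
        circleAverage (fun ζ => (ζ - z)⁻¹ * (ζ * Q ζ)) 0 t -
          Q z * circleAverage (fun ζ => (ζ / (ζ - z))) 0 t := by
    intro t ht hzt hst
    have hne : ∀ ζ ∈ sphere (0 : ℂ) t, ζ - z ≠ 0 := fun ζ hζ h => by
      rw [sub_eq_zero] at h
      rw [h, mem_sphere_zero_iff_norm] at hζ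
      exact hzt hζ
    have hinv : ContinuousOn (fun ζ => (ζ - z)⁻¹) (sphere (0 : ℂ) t) :=
      ContinuousOn.inv₀ (by fun_prop) hne
    have e1 := circleAverage_fun_smul (a := Q z) (f := fun ζ => ζ / (ζ - z)) (c := 0) (R := t)
    rw [smul_eq_mul] at e1
    rw [← e1, ← circleAverage_fun_sub]
    · refine circleAverage_congr_sphere fun ζ hζ => ?_
      rw [abs_of_pos ht] at hζ
      have h0 := hne ζ hζ
      simp only [dslope_of_ne Q (sub_ne_zero.1 h0), slope_def_field, smul_eq_mul]
      field_simp
    · exact ContinuousOn.circleIntegrable ht.le (hinv.mul (continuousOn_id.mul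
        (hQ.continuousOn.mono hst)))
    · exact ContinuousOn.circleIntegrable ht.le (continuousOn_const.mul
        (continuousOn_id.mul hinv))
  have hSone : circleAverage (fun ζ => ζ / (ζ - z)) 0 S = 1 := by
    have := DiffContOnCl.circleAverage_smul_div (f := fun _ => (1 : ℂ)) (c := 0) (R := S) (w := z)
      diffContOnCl_const (by rw [abs_of_pos hS0]; simpa using hzS)
    simpa using this
  have hszero : circleAverage (fun ζ => ζ / (ζ - z)) 0 s = 0 := by
    have : DiffContOnCl ℂ (fun ζ => ζ / (ζ - z)) (ball 0 |s|) := by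
      refine DifferentiableOn.diffContOnCl ?_
      refine differentiableOn_id.div (by fun_prop) fun ζ hζ h => ?_
      have := closure_ball_subset_closedBall hζ
      rw [sub_eq_zero] at h
      rw [h, mem_closedBall_zero_iff, abs_of_pos hs0] at this
      linarith
    rw [this.circleAverage, zero_div]
  have h1 := havg S hS0 hzS.ne fun ζ hζ => hsub ⟨sphere_subset_closedBall hζ, fun h => by
    rw [mem_sphere_zero_iff_norm] at hζ
    rw [mem_ball_zero_iff] at h
    linarith⟩
  have h2 := havg s hs0 hsz.ne' fun ζ hζ => hsub ⟨by
    rw [mem_sphere_zero_iff_norm] at hζ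
    rw [mem_closedBall_zero_iff]
    linarith, fun h => by
    rw [mem_sphere_zero_iff_norm] at hζ
    rw [mem_ball_zero_iff] at h
    linarith⟩
  rw [hSone, mul_one] at h1
  rw [hszero, mul_zero, sub_zero] at h2
  rw [← h2, ← hind, h1]
  ring

/-- Split `Q` into a part analytic inside and a part analytic outside. Conjugation keeps the real
part, and on `‖z‖ = 1`, where `conj z = z⁻¹`, the conjugate of the outside part is the restriction
of a function analytic inside. -/
theorem exists_re_eq_of_differentiableOn_annulus {Q : ℂ → ℂ} {r R : ℝ} (hr0 : 0 < r) (hr : r < 1)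
    (hR : 1 < R) (hQ : DifferentiableOn ℂ Q {z | r < ‖z‖ ∧ ‖z‖ < R}) :
    ∃ (H : ℂ → ℂ) (R' : ℝ), 1 < R' ∧ DifferentiableOn ℂ H (ball 0 R') ∧
      ∀ z, ‖z‖ = 1 → (H z).re = (Q z).re := by
  set s := (r + 1) / 2 with hs
  set S := (1 + R) / 2 with hS
  have hs0 : 0 < s := by positivity
  have hS0 : 0 < S := by positivity
  -- `Q` reflected in the unit circle; reflection carries the inner contour of radius `s < 1` to
  -- radius `s⁻¹ > 1`.
  set G : ℂ → ℂ := fun η => conj (Q (conj η)⁻¹) with hG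
  have hGc : ContinuousOn G (sphere 0 s⁻¹) := by
    refine Complex.continuous_conj.comp_continuousOn (hQ.continuousOn.comp
      (Complex.continuous_conj.continuousOn.inv₀ fun η hη => ?_) fun η hη => ?_)
    · rw [mem_sphere_zero_iff_norm] at hη
      rw [← norm_ne_zero_iff, RCLike.norm_conj, hη]
      positivity
    · rw [mem_sphere_zero_iff_norm] at hη
      simp only [mem_ofPred_eq, norm_inv, RCLike.norm_conj, hη, inv_inv]
      constructor <;> linarith
  have hQc : ContinuousOn (fun η => η * Q η) (sphere 0 S) := by
    refine continuousOn_id.mul (hQ.continuousOn.mono fun η hη => ?_)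
    rw [mem_sphere_zero_iff_norm] at hη
    simp only [mem_ofPred_eq, hη]
    constructor <;> linarith
  have h1 := differentiableOn_circleAverage_cauchy hS0 hQc
  have h2 := differentiableOn_circleAverage_cauchy (inv_pos.2 hs0) hGc
  refine ⟨fun z => circleAverage (fun η => (η - z)⁻¹ * (η * Q η)) 0 S +
    z * circleAverage (fun η => (η - z)⁻¹ * G η) 0 s⁻¹, min S s⁻¹,
    lt_min (by linarith) ((one_lt_inv₀ hs0).2 (by linarith)),
    (h1.mono (ball_subset_ball (min_le_left _ _))).add
      (differentiableOn_id.mul (h2.mono (ball_subset_ball (min_le_right _ _)))), fun z hz => ?_⟩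
  have hzc : z * conj z = 1 := by
    rw [Complex.mul_conj, Complex.normSq_eq_norm_sq, hz]; simp
  have hz0 : z ≠ 0 := left_ne_zero_of_mul_eq_one hzc
  have hzi : conj z = z⁻¹ := eq_inv_of_mul_eq_one_right hzc
  rw [eq_circleAverage_sub_circleAverage (s := s) (S := S) hs0 (by linarith) (by linarith) hQ
    (z := z) (by linarith) (by linarith), Complex.add_re, Complex.sub_re, sub_eq_add_neg]
  congr 1
  rw [← Complex.neg_re, ← Complex.conj_re (-_)]
  congr 1
  rw [map_neg]
  have e : conj (circleAverage (fun ζ => (ζ - z)⁻¹ * (ζ * Q ζ)) 0 s) =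
      circleAverage (fun ζ => conj ((ζ - z)⁻¹ * (ζ * Q ζ))) 0 s := by
    simp only [circleAverage_def, Complex.real_smul, map_mul, Complex.conj_ofReal]
    congr 1
    simp only [intervalIntegral.integral_of_le two_pi_pos.le]
    rw [← integral_conj]
    simp only [map_mul]
  rw [e]
  have hint : ∀ θ : ℝ, z * ((circleMap 0 s⁻¹ θ - z)⁻¹ * G (circleMap 0 s⁻¹ θ)) =
      - conj ((circleMap 0 s θ - z)⁻¹ * (circleMap 0 s θ * Q (circleMap 0 s θ))) := by
    intro θ
    have hη : (conj (circleMap 0 s⁻¹ θ))⁻¹ = circleMap 0 s θ := by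
      simp only [circleMap, zero_add, map_mul, Complex.conj_ofReal, ← Complex.exp_conj,
        Complex.conj_I, mul_inv, ← Complex.exp_neg]
      simp
    have hη' : conj (circleMap 0 s θ) = (circleMap 0 s⁻¹ θ)⁻¹ := by
      rw [← hη, map_inv₀, Complex.conj_conj]
    have hη0 : circleMap 0 s⁻¹ θ ≠ 0 := by simp [hs0.ne']
    have hηz : circleMap 0 s⁻¹ θ - z ≠ 0 := by
      intro h
      have := congrArg norm (sub_eq_zero.1 h)
      rw [hz, norm_circleMap_zero, abs_of_pos (inv_pos.2 hs0), inv_eq_one] at this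
      linarith
    simp only [hG, hη, map_mul, map_inv₀, map_sub, hη', hzi]
    generalize circleMap 0 s⁻¹ θ = η at hη0 hηz
    have h4 : η⁻¹ - z⁻¹ = -(η - z) * (η * z)⁻¹ := by
      field_simp; ring
    rw [h4]
    field_simp
  have e1 := circleAverage_fun_smul (a := z) (f := fun η => (η - z)⁻¹ * G η) (c := 0) (R := s⁻¹)
  rw [smul_eq_mul] at e1
  rw [← e1]
  simp only [circleAverage_def, smul_eq_mul, hint, intervalIntegral.integral_neg, smul_neg]

/-- The function `f(z) * conj (f (1 / conj z))` is analytic near the circle and equals `|f|² > 0` on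
it. It therefore stays in the slit plane on a thin annulus, where its power `p / 2` is analytic. -/
theorem exists_re_eq_norm_rpow {f : ℂ → ℂ} {R p : ℝ} (hR : 1 < R)
    (hf : DifferentiableOn ℂ f (ball 0 R)) (hne : ∀ z, ‖z‖ = 1 → f z ≠ 0) :
    ∃ (H : ℂ → ℂ) (R' : ℝ), 1 < R' ∧ DifferentiableOn ℂ H (ball 0 R') ∧
      ∀ z, ‖z‖ = 1 → (H z).re = ‖f z‖ ^ p := by
  set g : ℂ → ℂ := fun z => f z * conj (f (conj z⁻¹)) with hg
  set A : Set ℂ := {z | R⁻¹ < ‖z‖ ∧ ‖z‖ < R} with hA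
  have hR0 : 0 < R := by linarith
  have hAo : IsOpen A :=
    (isOpen_lt continuous_const continuous_norm).inter (isOpen_lt continuous_norm continuous_const)
  have hgd : DifferentiableOn ℂ g A := by
    intro z hz
    have hz0 : z ≠ 0 := norm_pos_iff.1 ((inv_pos.2 hR0).trans hz.1)
    have h1 : DifferentiableAt ℂ f z := hf.differentiableAt
      (isOpen_ball.mem_nhds (by simpa using hz.2))
    have h2 : DifferentiableAt ℂ f (conj z⁻¹) := hf.differentiableAt
      (isOpen_ball.mem_nhds (by
        rw [mem_ball_zero_iff, RCLike.norm_conj, norm_inv]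
        exact inv_lt_of_inv_lt₀ hR0 hz.1))
    have h3 : DifferentiableAt ℂ (conj ∘ f ∘ conj) z⁻¹ := by
      have := h2.conj_conj
      rwa [Complex.conj_conj] at this
    exact (h1.mul (h3.comp z (differentiableAt_inv hz0))).differentiableWithinAt
  set V : Set ℂ := A ∩ g ⁻¹' Complex.slitPlane with hV
  have hVo : IsOpen V := hgd.continuousOn.isOpen_inter_preimage hAo Complex.isOpen_slitPlane
  have hgc : ∀ z, ‖z‖ = 1 → g z = ((‖f z‖ ^ 2 : ℝ) : ℂ) := by
    intro z hz
    have hzc : z * conj z = 1 := by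
      rw [Complex.mul_conj, Complex.normSq_eq_norm_sq, hz]; simp
    have : conj z⁻¹ = z := by
      rw [map_inv₀]
      exact (eq_inv_of_mul_eq_one_left hzc).symm
    simp only [hg, this, Complex.mul_conj, Complex.normSq_eq_norm_sq]
  have hsV : sphere (0 : ℂ) 1 ⊆ V := by
    intro z hz
    rw [mem_sphere_zero_iff_norm] at hz
    refine ⟨⟨by rw [hz]; exact inv_lt_one_of_one_lt₀ hR, by rw [hz]; exact hR⟩, ?_⟩
    rw [mem_preimage, hgc z hz, Complex.ofReal_mem_slitPlane]
    have := norm_pos_iff.2 (hne z hz)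
    positivity
  obtain ⟨δ, hδ, hδV⟩ := (isCompact_sphere (0 : ℂ) 1).exists_thickening_subset_open hVo hsV
  set δ' := min δ (1 / 2) with hδ'
  have hδ'0 : 0 < δ' := lt_min hδ (by norm_num)
  have hδ'2 : δ' ≤ 1 / 2 := min_le_right _ _
  have hsub : {z : ℂ | 1 - δ' < ‖z‖ ∧ ‖z‖ < 1 + δ'} ⊆ V := by
    refine subset_trans (fun z hz => ?_) hδV
    have hz0 : 0 < ‖z‖ := by linarith [hz.1]
    rw [mem_thickening_iff]
    refine ⟨(‖z‖ : ℂ)⁻¹ * z, by simp [hz0.ne'], ?_⟩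
    have e : z - (‖z‖ : ℂ)⁻¹ * z = ((1 - ‖z‖⁻¹ : ℝ) : ℂ) * z := by push_cast; ring
    rw [dist_eq_norm, e, norm_mul, Complex.norm_real, norm_eq_abs]
    have : |1 - ‖z‖⁻¹| * ‖z‖ = |‖z‖ - 1| := by
      rw [← abs_of_pos hz0, ← abs_mul, abs_of_pos hz0]
      congr 1; field_simp
    rw [this]
    refine lt_of_lt_of_le ?_ (min_le_left δ (1 / 2))
    rw [abs_lt]
    constructor <;> linarith [hz.1, hz.2]
  obtain ⟨H, R', hR', hH, hHre⟩ := exists_re_eq_of_differentiableOn_annulus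
    (Q := fun z => g z ^ ((p / 2 : ℝ) : ℂ)) (r := 1 - δ') (R := 1 + δ') (by linarith)
    (by linarith) (by linarith) (by
      refine DifferentiableOn.cpow_const (hgd.mono fun z hz => (hsub hz).1) fun z hz => (hsub hz).2)
  refine ⟨H, R', hR', hH, fun z hz => ?_⟩
  rw [hHre z hz, hgc z hz, ← Complex.ofReal_cpow (by positivity), Complex.ofReal_re,
    ← rpow_natCast, ← rpow_mul (norm_nonneg _)]
  congr 1
  push_cast
  ring

/-! ### Moments of the functional and the reproducing kernel -/

theorem intervalIntegrable_pow_mul_one_sub_sq_rpow {α : ℝ} (hα : 0 < α) (n : ℕ) :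
    IntervalIntegrable (fun ρ : ℝ => ρ ^ (2 * n) * (ρ * (1 - ρ ^ 2) ^ (α - 1))) volume 0 1 :=
  (intervalIntegrable_mul_one_sub_sq_rpow hα).continuousOn_mul (by fun_prop)

theorem one_sub_pow_le {ρ : ℝ} (hρ : ρ ∈ Ioo (0 : ℝ) 1) (n : ℕ) :
    |1 - ρ ^ (2 * n)| ≤ 2 * n * (1 - ρ) := by
  rw [abs_of_nonneg (sub_nonneg.2 (pow_le_one₀ hρ.1.le hρ.2.le))]
  have := one_add_mul_le_pow (a := ρ - 1) (by linarith [hρ.1]) (2 * n)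
  rw [add_sub_cancel] at this
  push_cast at this
  linarith

theorem intervalIntegrable_one_sub_pow {α : ℝ} (hα : 0 < α) (n : ℕ) :
    IntervalIntegrable (fun ρ : ℝ => (1 - ρ ^ (2 * n)) * (ρ * (1 - ρ ^ 2) ^ (α - 2))) volume 0 1 :=
  intervalIntegrable_mul_mul_one_sub_sq_rpow hα (by fun_prop) fun _ hρ => one_sub_pow_le hρ n

/-- Integrate the derivative of `ρ ^ (2 * (n + 1)) * (1 - ρ ^ 2) ^ α`, which vanishes at both
endpoints. -/
theorem add_mul_integral_pow_succ {α : ℝ} (hα : 0 < α) (n : ℕ) :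
    (n + 1 + α) * ∫ ρ in (0 : ℝ)..1, ρ ^ (2 * (n + 1)) * (ρ * (1 - ρ ^ 2) ^ (α - 1)) =
      (n + 1) * ∫ ρ in (0 : ℝ)..1, ρ ^ (2 * n) * (ρ * (1 - ρ ^ 2) ^ (α - 1)) := by
  have h0 := (intervalIntegrable_pow_mul_one_sub_sq_rpow hα n).const_mul (2 * (n + 1))
  have h1 := (intervalIntegrable_pow_mul_one_sub_sq_rpow hα (n + 1)).const_mul (2 * (n + 1 + α))
  have := intervalIntegral.integral_eq_sub_of_hasDerivAt_of_le (a := 0) (b := 1) zero_le_one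
    (f := fun ρ : ℝ => ρ ^ (2 * (n + 1)) * (1 - ρ ^ 2) ^ α)
    (f' := fun ρ => 2 * (n + 1) * (ρ ^ (2 * n) * (ρ * (1 - ρ ^ 2) ^ (α - 1))) -
      2 * (n + 1 + α) * (ρ ^ (2 * (n + 1)) * (ρ * (1 - ρ ^ 2) ^ (α - 1))))
    ((continuous_id.pow _).continuousOn.mul
      (ContinuousOn.rpow_const (by fun_prop) fun _ _ => Or.inr hα.le)) (fun ρ hρ => by
      refine ((hasDerivAt_pow (2 * (n + 1)) ρ).mul (hasDerivAt_one_sub_sq_rpow α hρ)).congr_deriv ?_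
      have e : (1 - ρ ^ 2) ^ α = (1 - ρ ^ 2) * (1 - ρ ^ 2) ^ (α - 1) := by
        rw [rpow_sub_one (one_sub_sq_pos hρ).ne' α]
        field_simp [(one_sub_sq_pos hρ).ne']
      rw [e, show 2 * (n + 1) - 1 = 2 * n + 1 by omega]
      push_cast
      ring) (h0.sub h1)
  rw [intervalIntegral.integral_sub h0 h1] at this
  simp only [intervalIntegral.integral_const_mul] at this
  simp [zero_rpow hα.ne'] at this
  linarith

theorem meanFunctional_pow {α : ℝ} (hα : 0 < α) (n : ℕ) :
    meanFunctional α (fun ρ => ρ ^ (2 * n)) =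
      2 * (n + α) * ∫ ρ in (0 : ℝ)..1, ρ ^ (2 * n) * (ρ * (1 - ρ ^ 2) ^ (α - 1)) := by
  induction n with
  | zero =>
    have := intervalIntegral.integral_eq_sub_of_hasDerivAt_of_le (a := 0) (b := 1) zero_le_one
      (f := fun ρ : ℝ => -(1 - ρ ^ 2) ^ α)
      (f' := fun ρ => 2 * α * (ρ * (1 - ρ ^ 2) ^ (α - 1)))
      (ContinuousOn.neg (ContinuousOn.rpow_const (by fun_prop) fun _ _ => Or.inr hα.le))
      (fun ρ hρ => by
        refine (hasDerivAt_one_sub_sq_rpow α hρ).neg.congr_deriv ?_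
        ring) ((intervalIntegrable_mul_one_sub_sq_rpow hα).const_mul _)
    rw [intervalIntegral.integral_const_mul] at this
    simp [zero_rpow hα.ne'] at this
    simp [meanFunctional, this]
  | succ n ih =>
    have hrec := add_mul_integral_pow_succ hα n
    have hdiff : (∫ ρ in (0 : ℝ)..1, (1 - ρ ^ (2 * (n + 1))) * (ρ * (1 - ρ ^ 2) ^ (α - 2))) =
        (∫ ρ in (0 : ℝ)..1, (1 - ρ ^ (2 * n)) * (ρ * (1 - ρ ^ 2) ^ (α - 2))) +
          ∫ ρ in (0 : ℝ)..1, ρ ^ (2 * n) * (ρ * (1 - ρ ^ 2) ^ (α - 1)) := by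
      rw [← intervalIntegral.integral_add (intervalIntegrable_one_sub_pow hα n)
        (intervalIntegrable_pow_mul_one_sub_sq_rpow hα n)]
      refine intervalIntegral.integral_congr_Ioo_of_le zero_le_one fun ρ hρ => ?_
      have e : (1 - ρ ^ 2) ^ (α - 1) = (1 - ρ ^ 2) * (1 - ρ ^ 2) ^ (α - 2) := by
        rw [show α - 2 = α - 1 - 1 by ring, rpow_sub_one (one_sub_sq_pos hρ).ne' (α - 1)]
        field_simp [(one_sub_sq_pos hρ).ne']
      simp only [e]
      ring
    simp only [meanFunctional, one_pow] at ih ⊢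
    rw [hdiff]
    push_cast
    linear_combination ih - 2 * hrec

theorem meanFunctional_pow_succ {α : ℝ} (hα : 0 < α) (n : ℕ) :
    (n + α) * meanFunctional α (fun ρ => ρ ^ (2 * (n + 1))) =
      (n + 1) * meanFunctional α (fun ρ => ρ ^ (2 * n)) := by
  rw [meanFunctional_pow hα, meanFunctional_pow hα]
  have hrec := add_mul_integral_pow_succ hα n
  push_cast
  linear_combination 2 * (n + α) * hrec

/-- The recurrence gives the moments `n! / (α (α+1) ⋯ (α+n-1))`, the reciprocals of the Taylor
coefficients of `(1 - x)^(-α)`. This is why that kernel reproduces. -/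
theorem ringChoose_mul_meanFunctional_pow {α : ℝ} (hα : 0 < α) (n : ℕ) :
    Ring.choose ((α : ℂ) + n - 1) n * (meanFunctional α (fun ρ => ρ ^ (2 * n)) : ℝ) = 1 := by
  rw [← Ring.multichoose_eq]
  have hm : ∀ n, (n.factorial : ℂ) * Ring.multichoose (α : ℂ) n = (ascPochhammer ℂ n).eval (α : ℂ) := by
    intro n
    have := Ring.factorial_nsmul_multichoose_eq_ascPochhammer (α : ℂ) n
    rw [nsmul_eq_mul] at this
    rw [this, Polynomial.ascPochhammer_smeval_eq_eval]
  induction n with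
  | zero => simp [meanFunctional]
  | succ n ih =>
    have h1 := hm n
    have h2 := hm (n + 1)
    rw [ascPochhammer_succ_eval, ← h1, Nat.factorial_succ] at h2
    have hf : (n.factorial : ℂ) ≠ 0 := by exact_mod_cast n.factorial_ne_zero
    have h3 : ((n : ℂ) + 1) * Ring.multichoose (α : ℂ) (n + 1) =
        Ring.multichoose (α : ℂ) n * (α + n) := by
      push_cast at h2
      apply mul_left_cancel₀ hf
      linear_combination h2
    have h4 : ((n : ℂ) + α) * (meanFunctional α (fun ρ => ρ ^ (2 * (n + 1))) : ℝ) =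
        (n + 1) * (meanFunctional α (fun ρ => ρ ^ (2 * n)) : ℝ) := by
      exact_mod_cast meanFunctional_pow_succ hα n
    have hn : (n : ℂ) + 1 ≠ 0 := by exact_mod_cast n.succ_ne_zero
    apply mul_left_cancel₀ hn
    rw [← mul_assoc, h3, mul_assoc, add_comm (α : ℂ), h4]
    linear_combination ((n : ℂ) + 1) * ih

theorem hasSum_one_sub_cpow (α : ℝ) {x : ℂ} (hx : ‖x‖ < 1) :
    HasSum (fun n : ℕ => Ring.choose ((α : ℂ) + n - 1) n * x ^ n) (1 / (1 - x) ^ (α : ℂ)) := by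
  have h := (Complex.one_div_one_sub_cpow_hasFPowerSeriesOnBall_zero (α : ℂ)).hasSum
    (y := x) (by simpa [enorm_eq_nnnorm, ← NNReal.coe_lt_coe] using hx)
  simpa [FormalMultilinearSeries.ofScalars_apply_eq, mul_comm] using h

theorem summable_nat_mul_ringChoose (α : ℝ) {x : ℝ} (hx0 : 0 ≤ x) (hx : x < 1) :
    Summable (fun n : ℕ => n * (‖Ring.choose ((α : ℂ) + n - 1) n‖ * x ^ n)) := by
  obtain ⟨y, hxy, hy⟩ := exists_between hx
  have hy0 : 0 < y := hx0.trans_lt hxy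
  have h1 : Summable (fun n : ℕ => ‖Ring.choose ((α : ℂ) + n - 1) n‖ * y ^ n) := by
    have := (hasSum_one_sub_cpow α (x := y) (by simpa [abs_of_pos hy0] using hy)).summable.norm
    simpa [abs_of_pos hy0] using this
  have h2 : Tendsto (fun n : ℕ => n * (x / y) ^ n) atTop (𝓝 0) :=
    tendsto_self_mul_const_pow_of_lt_one (by positivity) ((div_lt_one hy0).2 hxy)
  refine h1.of_norm_bounded_eventually_nat ?_
  filter_upwards [h2.eventually (gt_mem_nhds one_pos)] with n hn
  rw [norm_of_nonneg (by positivity)]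
  calc (n : ℝ) * (‖Ring.choose ((α : ℂ) + n - 1) n‖ * x ^ n)
      = (n * (x / y) ^ n) * (‖Ring.choose ((α : ℂ) + n - 1) n‖ * y ^ n) := by
        rw [div_pow]; field_simp
    _ ≤ 1 * (‖Ring.choose ((α : ℂ) + n - 1) n‖ * y ^ n) := by gcongr
    _ = _ := one_mul _

/-- Termwise integration. The weight `n` in `hb` comes from `|1 - ρ ^ (2 * n)| ≤ 2 * n * (1 - ρ)`,
which compensates the exponent `α - 2`. -/
theorem hasSum_meanFunctional {α : ℝ} (hα : 0 < α) {b : ℕ → ℝ} {M : ℝ → ℝ}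
    (hM : ∀ ρ ∈ Icc (0 : ℝ) 1, HasSum (fun n => b n * ρ ^ (2 * n)) (M ρ))
    (hb : Summable fun n : ℕ => n * |b n|) :
    HasSum (fun n => b n * meanFunctional α (fun ρ => ρ ^ (2 * n))) (meanFunctional α M) := by
  have hM1 : HasSum b (M 1) := by simpa using hM 1 ⟨zero_le_one, le_rfl⟩
  have hint := fun n => (intervalIntegrable_one_sub_pow hα n).const_mul (b n)
  have hI := intervalIntegrable_mul_one_sub_sq_rpow hα
  replace hint : ∀ n : ℕ, IntegrableOn
      (fun ρ : ℝ => b n * ((1 - ρ ^ (2 * n)) * (ρ * (1 - ρ ^ 2) ^ (α - 2)))) (Ioo 0 1) := fun n => ((intervalIntegrable_iff_integrableOn_Ioc_of_le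
    zero_le_one).1 (hint n)).mono_set Ioo_subset_Ioc_self
  rw [intervalIntegrable_iff_integrableOn_Ioo_of_le zero_le_one] at hI
  have key : HasSum
      (fun n => ∫ ρ in Ioo (0 : ℝ) 1, b n * ((1 - ρ ^ (2 * n)) * (ρ * (1 - ρ ^ 2) ^ (α - 2))))
      (∫ ρ in Ioo (0 : ℝ) 1, (M 1 - M ρ) * (ρ * (1 - ρ ^ 2) ^ (α - 2))) := by
    have h := hasSum_integral_of_summable_integral_norm hint ?_
    · have e : ∀ ρ ∈ Ioo (0 : ℝ) 1, (M 1 - M ρ) * (ρ * (1 - ρ ^ 2) ^ (α - 2)) =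
          ∑' n, b n * ((1 - ρ ^ (2 * n)) * (ρ * (1 - ρ ^ 2) ^ (α - 2))) := fun ρ hρ => by
        rw [← ((hM1.sub (hM ρ (Ioo_subset_Icc_self hρ))).mul_right
          (ρ * (1 - ρ ^ 2) ^ (α - 2))).tsum_eq]
        congr 1
        ext n
        ring
      rwa [setIntegral_congr_fun measurableSet_Ioo e]
    · refine Summable.of_nonneg_of_le (fun n => integral_nonneg fun _ => norm_nonneg _) (fun n => ?_)
        (hb.mul_right (2 * ∫ ρ in Ioo (0 : ℝ) 1, ρ * (1 - ρ ^ 2) ^ (α - 1)))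
      calc ∫ ρ in Ioo (0 : ℝ) 1, ‖b n * ((1 - ρ ^ (2 * n)) * (ρ * (1 - ρ ^ 2) ^ (α - 2)))‖
          ≤ ∫ ρ in Ioo (0 : ℝ) 1, (|b n| * (2 * n)) * (ρ * (1 - ρ ^ 2) ^ (α - 1)) := by
            refine setIntegral_mono_on (hint n).norm (hI.const_mul _) measurableSet_Ioo
              fun ρ hρ => ?_
            have h2 : 0 ≤ ρ * (1 - ρ ^ 2) ^ (α - 2) :=
              mul_nonneg hρ.1.le (rpow_nonneg (one_sub_sq_pos hρ).le _)
            rw [norm_mul, norm_mul, norm_eq_abs, norm_eq_abs, norm_of_nonneg h2, mul_assoc]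
            refine mul_le_mul_of_nonneg_left ?_ (abs_nonneg _)
            calc |1 - ρ ^ (2 * n)| * (ρ * (1 - ρ ^ 2) ^ (α - 2))
                ≤ 2 * n * (1 - ρ) * (ρ * (1 - ρ ^ 2) ^ (α - 2)) := by
                  gcongr; exact one_sub_pow_le hρ n
              _ = 2 * n * ((1 - ρ) * (ρ * (1 - ρ ^ 2) ^ (α - 2))) := by ring
              _ ≤ _ := mul_le_mul_of_nonneg_left (one_sub_mul_rpow_le hρ) (by positivity)
        _ = _ := by rw [integral_const_mul]; ring
  have := hM1.add (key.mul_left (2 * (1 - α)))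
  simp only [meanFunctional, intervalIntegral.integral_of_le zero_le_one,
    integral_Ioc_eq_integral_Ioo]
  refine this.congr_fun fun n => ?_
  rw [integral_const_mul]
  simp only [one_pow]
  ring

/-- On `‖z‖ = t` one has `conj z = t² / z`, so apart from `t ^ (2 * n)` this is the contour integral
of `F z / z ^ (n + 1)`, which does not depend on the radius. -/
theorem circleAverage_mul_conj_pow {F : ℂ → ℂ} {R : ℝ} (hR : 1 < R)
    (hF : DifferentiableOn ℂ F (ball 0 R)) {ρ : ℝ} (hρ : ρ ∈ Icc (0 : ℝ) 1) (n : ℕ) :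
    circleAverage (fun z => F z * conj z ^ n) 0 ρ =
      ρ ^ (2 * n) * circleAverage (fun z => F z * conj z ^ n) 0 1 := by
  rcases n.eq_zero_or_pos with rfl | hn
  · have : ∀ ρ ∈ Icc (0 : ℝ) 1, circleAverage F 0 ρ = F 0 := fun ρ hρ => by
      refine DiffContOnCl.circleAverage (DifferentiableOn.diffContOnCl (hF.mono ?_))
      refine closure_ball_subset_closedBall.trans (closedBall_subset_ball ?_)
      rw [abs_of_nonneg hρ.1]; linarith [hρ.2]
    simp [this ρ hρ, this 1 ⟨zero_le_one, le_rfl⟩]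
  rcases hρ.1.eq_or_lt with rfl | h0
  · simp [hn.ne']
  have hinv : ∀ t, 0 < t → circleAverage (fun z => F z * conj z ^ n) 0 t =
      t ^ (2 * n) * circleAverage (fun z => F z * (z⁻¹) ^ n) 0 t := by
    intro t ht
    have e1 := circleAverage_fun_smul (a := (t : ℂ) ^ (2 * n)) (f := fun z => F z * (z⁻¹) ^ n)
      (c := 0) (R := t)
    rw [smul_eq_mul] at e1
    rw [← e1]
    refine circleAverage_congr_sphere fun z hz => ?_
    rw [abs_of_pos ht, mem_sphere_zero_iff_norm] at hz
    have hz0 : z ≠ 0 := norm_pos_iff.1 (hz ▸ ht)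
    have : conj z = t ^ 2 * z⁻¹ := by
      rw [eq_mul_inv_iff_mul_eq₀ hz0, mul_comm, Complex.mul_conj, Complex.normSq_eq_norm_sq, hz]
      push_cast; rfl
    simp only [this, smul_eq_mul]
    ring
  rw [hinv ρ h0, hinv 1 one_pos, Complex.ofReal_one, one_pow, one_mul]
  congr 1
  rw [circleAverage_eq_circleIntegral h0.ne', circleAverage_eq_circleIntegral one_ne_zero]
  congr 1
  symm
  have hd : DifferentiableOn ℂ (fun z => F z * (z⁻¹) ^ n) (closedBall 0 1 \ ball 0 ρ) := by
    refine (hF.mono (sdiff_subset.trans (closedBall_subset_ball hR))).mul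
      (DifferentiableOn.pow (differentiableOn_id.inv fun z hz h => hz.2 ?_) _)
    rw [show z = 0 from h]
    simpa using h0
  refine Complex.circleIntegral_sub_center_inv_smul_eq_of_differentiable_on_annulus_off_countable
    h0 hρ.2 countable_empty hd.continuousOn fun z hz => ?_
  have hm : ball (0 : ℂ) 1 \ closedBall 0 ρ ∈ 𝓝 z :=
    (isOpen_ball.sdiff isClosed_closedBall).mem_nhds hz.1
  exact hd.differentiableAt (mem_of_superset hm
    (sdiff_subset_sdiff ball_subset_closedBall ball_subset_closedBall))

theorem hasSum_circleAverage_mul_conj_pow {F : ℂ → ℂ} {ρ : ℝ} (hρ : 0 ≤ ρ)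
    (hF : ContinuousOn F (sphere 0 ρ)) {d : ℕ → ℂ} {k : ℂ → ℂ}
    (hd : Summable fun n => ‖d n‖ * ρ ^ n)
    (hk : ∀ z, ‖z‖ = ρ → HasSum (fun n => d n * conj z ^ n) (k z)) :
    HasSum (fun n => d n * circleAverage (fun z => F z * conj z ^ n) 0 ρ)
      (circleAverage (fun z => F z * k z) 0 ρ) := by
  obtain ⟨C, hC⟩ := (isCompact_sphere (0 : ℂ) ρ).exists_bound_of_continuousOn hF
  have hcm : ∀ θ, ‖circleMap 0 ρ θ‖ = ρ := fun θ => by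
    rw [norm_circleMap_zero, abs_of_nonneg hρ]
  have hFc : Continuous fun θ => F (circleMap 0 ρ θ) :=
    hF.comp_continuous (by fun_prop) fun θ => by simp [hcm]
  have h := intervalIntegral.hasSum_integral_of_dominated_convergence (a := 0) (b := 2 * π)
    (μ := volume)
    (F := fun n θ => d n * (F (circleMap 0 ρ θ) * conj (circleMap 0 ρ θ) ^ n))
    (f := fun θ => F (circleMap 0 ρ θ) * k (circleMap 0 ρ θ))
    (fun n _ => C * (‖d n‖ * ρ ^ n)) (fun n => ?_) (fun n => ?_) ?_ ?_ ?_
  · have h2 := h.mul_left ((2 * π : ℂ)⁻¹)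
    simp only [circleAverage_def, Complex.real_smul]
    push_cast
    refine h2.congr_fun fun n => ?_
    rw [intervalIntegral.integral_const_mul]
    ring
  · refine Continuous.aestronglyMeasurable ?_
    refine continuous_const.mul (hFc.mul ((Complex.continuous_conj.comp ?_).pow n))
    fun_prop
  · refine Eventually.of_forall fun θ _ => ?_
    rw [norm_mul, norm_mul, norm_pow, RCLike.norm_conj, hcm]
    have := hC (circleMap 0 ρ θ) (by simp [hcm])
    calc ‖d n‖ * (‖F (circleMap 0 ρ θ)‖ * ρ ^ n) ≤ ‖d n‖ * (C * ρ ^ n) := by gcongr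
      _ = _ := by ring
  · exact Eventually.of_forall fun θ _ => hd.mul_left C
  · simp
  · refine Eventually.of_forall fun θ _ => ?_
    exact ((hk _ (hcm θ)).mul_left (F (circleMap 0 ρ θ))).congr_fun fun n => by ring

/-- The reproducing property of the kernel `(1 - conj w * z)^(-α)`. -/
theorem meanFunctional_mul_kernel {α R : ℝ} (hα : 0 < α) (hR : 1 < R) {F : ℂ → ℂ}
    (hF : DifferentiableOn ℂ F (ball 0 R)) {w : ℂ} (hw : ‖w‖ < 1) :
    meanFunctional α (fun ρ =>
      (circleAverage (fun z => F z * (1 / (1 - w * conj z) ^ (α : ℂ))) 0 ρ).re) = (F w).re := by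
  set a : ℕ → ℂ := fun n => Ring.choose ((α : ℂ) + n - 1) n with ha
  set F' : ℕ → ℂ := fun n => circleAverage (fun z => F z * conj z ^ n) 0 1 with hF'
  have hsph : ∀ ρ ∈ Icc (0 : ℝ) 1, ContinuousOn F (sphere 0 ρ) := fun ρ hρ =>
    hF.continuousOn.mono (sphere_subset_closedBall.trans
      (closedBall_subset_ball (hρ.2.trans_lt hR)))
  have hsum := (hasSum_one_sub_cpow α (x := (‖w‖ : ℂ)) (by simpa using hw)).summable.norm
  simp only [norm_mul, norm_pow, Complex.norm_real, norm_norm] at hsum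
  have hM : ∀ ρ ∈ Icc (0 : ℝ) 1, HasSum (fun n => (a n * w ^ n * F' n) * ((ρ ^ (2 * n) : ℝ) : ℂ))
      (circleAverage (fun z => F z * (1 / (1 - w * conj z) ^ (α : ℂ))) 0 ρ) := by
    intro ρ hρ
    have := hasSum_circleAverage_mul_conj_pow (d := fun n => a n * w ^ n)
      (k := fun z => 1 / (1 - w * conj z) ^ (α : ℂ)) hρ.1 (hsph ρ hρ) ?_ ?_
    · convert this using 1
      ext n
      rw [circleAverage_mul_conj_pow hR hF hρ]
      push_cast
      ring
    · refine hsum.of_nonneg_of_le (fun n => mul_nonneg (norm_nonneg _) (pow_nonneg hρ.1 n))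
        fun n => ?_
      rw [norm_mul, norm_pow]
      exact mul_le_of_le_one_right (by positivity) (pow_le_one₀ hρ.1 hρ.2)
    · intro z hz
      have := hasSum_one_sub_cpow α (x := w * conj z) (by
        rw [norm_mul, RCLike.norm_conj, hz]
        nlinarith [norm_nonneg w, hρ.1, hρ.2])
      convert this using 1
      ext n
      rw [mul_pow]; ring
  -- Cauchy's formula on the unit circle, with the kernel expanded as a geometric series. The
  -- moments cancel the coefficients `a n` in `hM` and leave this series.
  have hFw : HasSum (fun n => w ^ n * F' n) (F w) := by
    have := hasSum_circleAverage_mul_conj_pow (d := fun n => w ^ n)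
      (k := fun z => (1 - w * conj z)⁻¹) zero_le_one (hsph 1 ⟨zero_le_one, le_rfl⟩) ?_ ?_
    · convert this using 1
      have h := DiffContOnCl.circleAverage_smul_div (f := F) (c := 0) (R := 1) (w := w)
        (DifferentiableOn.diffContOnCl (hF.mono (closure_ball_subset_closedBall.trans
          (closedBall_subset_ball (by simpa using hR))))) (by simpa using hw)
      rw [← h]
      refine circleAverage_congr_sphere fun z hz => ?_
      rw [abs_one, mem_sphere_zero_iff_norm] at hz
      have hz0 : z ≠ 0 := by rw [← norm_pos_iff, hz]; exact one_pos
      have hzi : conj z = z⁻¹ := by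
        refine eq_inv_of_mul_eq_one_right ?_
        rw [Complex.mul_conj, Complex.normSq_eq_norm_sq, hz]
        simp
      have hzw : z - w ≠ 0 := fun h => by
        rw [sub_eq_zero] at h
        rw [h] at hz
        exact hw.ne hz
      simp only [hzi, sub_zero, smul_eq_mul]
      have : 1 - w * z⁻¹ = (z - w) * z⁻¹ := by field_simp
      rw [this]
      field_simp
    · simpa using summable_geometric_of_lt_one (norm_nonneg w) hw
    · intro z hz
      have := hasSum_geometric_of_norm_lt_one (ξ := w * conj z) (by
        rw [norm_mul, RCLike.norm_conj, hz, mul_one]; exact hw)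
      simpa [mul_pow] using this
  obtain ⟨C, hC⟩ : ∃ C, ∀ n, ‖F' n‖ ≤ C := by
    obtain ⟨C, hC⟩ := (isCompact_sphere (0 : ℂ) 1).exists_bound_of_continuousOn
      (hsph 1 ⟨zero_le_one, le_rfl⟩)
    refine ⟨C, fun n => ?_⟩
    have h1 := intervalIntegral.norm_integral_le_of_norm_le_const (a := 0) (b := 2 * π)
      (f := fun θ => F (circleMap 0 1 θ) * conj (circleMap 0 1 θ) ^ n) (C := C) fun θ _ => by
        have := hC (circleMap 0 1 θ) (by simp)
        simpa using this
    simp only [hF', circleAverage_def, norm_smul]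
    rw [sub_zero, abs_of_pos two_pi_pos] at h1
    rw [norm_of_nonneg (by positivity), inv_mul_le_iff₀ two_pi_pos]
    linarith
  have hre : ∀ ρ ∈ Icc (0 : ℝ) 1, HasSum (fun n => (a n * w ^ n * F' n).re * ρ ^ (2 * n))
      (circleAverage (fun z => F z * (1 / (1 - w * conj z) ^ (α : ℂ))) 0 ρ).re := by
    intro ρ hρ
    have := Complex.hasSum_re (hM ρ hρ)
    simpa only [Complex.re_mul_ofReal] using this
  have hfin := hasSum_meanFunctional hα hre ?_
  · have h2 := Complex.hasSum_re hFw
    refine hfin.unique ?_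
    convert h2 using 1
    ext n
    rw [← Complex.re_mul_ofReal]
    congr 1
    have := ringChoose_mul_meanFunctional_pow hα n
    linear_combination (w ^ n * F' n) * this
  · refine ((summable_nat_mul_ringChoose α (norm_nonneg w) hw).mul_right C).of_nonneg_of_le
      (fun n => by positivity) fun n => ?_
    rw [mul_assoc (n : ℝ)]
    refine mul_le_mul_of_nonneg_left ((Complex.abs_re_le_norm _).trans ?_) (Nat.cast_nonneg n)
    rw [norm_mul, norm_mul, norm_pow]
    gcongr
    exact hC n

/-! ### The disc involution and the Möbius operator -/

/-- The involutive automorphism of the unit disc that interchanges `0` and `w`. -/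
noncomputable def discInvolution (w z : ℂ) : ℂ := (w - z) / (1 - conj w * z)

/-- The modulus of the derivative of `discInvolution w`. -/
noncomputable def discJacobian (w z : ℂ) : ℝ := (1 - ‖w‖ ^ 2) / ‖1 - conj w * z‖ ^ 2

theorem re_one_sub_conj_mul_pos {w z : ℂ} (hw : ‖w‖ < 1) (hz : ‖z‖ ≤ 1) :
    0 < (1 - conj w * z).re := by
  have h := Complex.re_le_norm (conj w * z)
  rw [norm_mul, RCLike.norm_conj] at h
  rw [Complex.sub_re, Complex.one_re]
  nlinarith [norm_nonneg w, norm_nonneg z]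

theorem ne_zero_of_re_pos {z : ℂ} (h : 0 < z.re) : z ≠ 0 := by
  rintro rfl
  simp at h

theorem one_sub_norm_sq_pos {w : ℂ} (hw : ‖w‖ < 1) : 0 < 1 - ‖w‖ ^ 2 := by
  nlinarith [norm_nonneg w]

theorem discJacobian_pos {w z : ℂ} (hw : ‖w‖ < 1) (hz : 0 < (1 - conj w * z).re) :
    0 < discJacobian w z :=
  div_pos (one_sub_norm_sq_pos hw) (pow_pos (norm_pos_iff.2 (ne_zero_of_re_pos hz)) 2)

theorem one_sub_norm_discInvolution_sq {w z : ℂ} (hz : 0 < (1 - conj w * z).re) :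
    1 - ‖discInvolution w z‖ ^ 2 = discJacobian w z * (1 - ‖z‖ ^ 2) := by
  have h0 : ‖1 - conj w * z‖ ^ 2 ≠ 0 := pow_ne_zero 2 (norm_ne_zero_iff.2 (ne_zero_of_re_pos hz))
  rw [discInvolution, discJacobian, norm_div, div_pow, div_mul_eq_mul_div, eq_div_iff h0,
    sub_mul, div_mul_cancel₀ _ h0]
  simp only [← Complex.normSq_eq_norm_sq, Complex.normSq_apply]
  simp
  ring

theorem norm_discInvolution_lt_one {w z : ℂ} (hw : ‖w‖ < 1) (hz : ‖z‖ < 1) :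
    ‖discInvolution w z‖ < 1 := by
  have h := re_one_sub_conj_mul_pos hw hz.le
  have e := one_sub_norm_discInvolution_sq h
  have := mul_pos (discJacobian_pos hw h) (one_sub_norm_sq_pos hz)
  nlinarith [norm_nonneg (discInvolution w z)]

theorem norm_discInvolution_eq_one {w z : ℂ} (hw : ‖w‖ < 1) (hz : ‖z‖ = 1) :
    ‖discInvolution w z‖ = 1 := by
  have e := one_sub_norm_discInvolution_sq (re_one_sub_conj_mul_pos hw hz.le)
  rw [hz] at e
  have : ‖discInvolution w z‖ ^ 2 = 1 := by linarith
  exact (pow_eq_one_iff_of_nonneg (norm_nonneg _) two_ne_zero).1 this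

theorem norm_discInvolution_le_one {w z : ℂ} (hw : ‖w‖ < 1) (hz : ‖z‖ ≤ 1) :
    ‖discInvolution w z‖ ≤ 1 := by
  rcases hz.lt_or_eq with h | h
  · exact (norm_discInvolution_lt_one hw h).le
  · exact (norm_discInvolution_eq_one hw h).le

theorem discInvolution_self (w : ℂ) : discInvolution w w = 0 := by simp [discInvolution]

theorem one_sub_conj_mul_discInvolution {w z : ℂ} (hz : 0 < (1 - conj w * z).re) :
    1 - conj w * discInvolution w z = ((1 - ‖w‖ ^ 2 : ℝ) : ℂ) / (1 - conj w * z) := by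
  have h0 := ne_zero_of_re_pos hz
  rw [discInvolution, eq_div_iff h0, sub_mul, mul_div_assoc', div_mul_cancel₀ _ h0]
  push_cast
  rw [← Complex.conj_mul']
  ring

theorem discInvolution_discInvolution {w z : ℂ} (hw : ‖w‖ < 1) (hz : 0 < (1 - conj w * z).re) :
    discInvolution w (discInvolution w z) = z := by
  have h0 := ne_zero_of_re_pos hz
  have h1 : ((1 - ‖w‖ ^ 2 : ℝ) : ℂ) ≠ 0 := by
    exact_mod_cast (one_sub_norm_sq_pos hw).ne'
  have e : w - discInvolution w z = ((1 - ‖w‖ ^ 2 : ℝ) : ℂ) * z / (1 - conj w * z) := by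
    rw [discInvolution, eq_div_iff h0, sub_mul, div_mul_cancel₀ _ h0]
    push_cast
    rw [← Complex.conj_mul']
    ring
  rw [discInvolution, one_sub_conj_mul_discInvolution hz, e, div_div_div_cancel_right₀ h0,
    mul_div_cancel_left₀ _ h1]

theorem hasDerivAt_discInvolution {w z : ℂ} (hz : 0 < (1 - conj w * z).re) :
    HasDerivAt (discInvolution w) (-((1 - ‖w‖ ^ 2 : ℝ) : ℂ) / (1 - conj w * z) ^ 2) z := by
  have h1 : HasDerivAt (fun z => w - z) (-1) z := by simpa using (hasDerivAt_id z).const_sub w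
  have h2 : HasDerivAt (fun z => 1 - conj w * z) (-conj w) z := by
    simpa using ((hasDerivAt_id z).const_mul (conj w)).const_sub 1
  refine (h1.div h2 (ne_zero_of_re_pos hz)).congr_deriv ?_
  congr 1
  push_cast
  rw [← Complex.conj_mul']
  ring

theorem norm_deriv_discInvolution {w z : ℂ} (hw : ‖w‖ < 1) :
    ‖-((1 - ‖w‖ ^ 2 : ℝ) : ℂ) / (1 - conj w * z) ^ 2‖ = discJacobian w z := by
  rw [norm_div, norm_neg, Complex.norm_real, norm_of_nonneg (one_sub_norm_sq_pos hw).le, norm_pow,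
    discJacobian]

/-- The closed disc is compact and mapped into itself, so a neighbourhood of it goes into the larger
ball; analyticity across the circle thus survives the operator. -/
theorem exists_radius_discInvolution {w : ℂ} (hw : ‖w‖ < 1) {R : ℝ} (hR : 1 < R) :
    ∃ R' > 1, ∀ z ∈ ball (0 : ℂ) R', 0 < (1 - conj w * z).re ∧ discInvolution w z ∈ ball 0 R := by
  have ho : IsOpen {z : ℂ | 0 < (1 - conj w * z).re} :=
    isOpen_lt continuous_const (by fun_prop)
  have hc : ContinuousOn (discInvolution w) {z : ℂ | 0 < (1 - conj w * z).re} := fun z hz =>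
    (hasDerivAt_discInvolution hz).continuousAt.continuousWithinAt
  obtain ⟨δ, hδ, hsub⟩ := (isCompact_closedBall (0 : ℂ) 1).exists_thickening_subset_open
    (hc.isOpen_inter_preimage ho (isOpen_ball (x := 0) (ε := R))) fun z hz => by
      rw [mem_closedBall_zero_iff] at hz
      refine ⟨re_one_sub_conj_mul_pos hw hz, ?_⟩
      rw [mem_preimage, mem_ball_zero_iff]
      exact (norm_discInvolution_le_one hw hz).trans_lt hR
  rw [thickening_closedBall hδ zero_le_one] at hsub
  exact ⟨δ + 1, by linarith, fun z hz => hsub hz⟩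

theorem norm_moebiusOp_rpow {w z : ℂ} (hw : ‖w‖ < 1) {α p : ℝ} (hp : 0 < p)
    (hz : 0 < (1 - conj w * z).re) (f : ℂ → ℂ) :
    ‖moebiusOp w (α / p) f z‖ ^ p = ‖f (discInvolution w z)‖ ^ p * discJacobian w z ^ α := by
  have h0 : 0 < ‖1 - conj w * z‖ := norm_pos_iff.2 (ne_zero_of_re_pos hz)
  have h1 := one_sub_norm_sq_pos hw
  rw [moebiusOp, norm_mul, mul_rpow (norm_nonneg _) (norm_nonneg _), norm_div, Complex.norm_real,
    Complex.norm_cpow_real, norm_of_nonneg (rpow_nonneg h1.le _), discJacobian,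
    div_rpow (by positivity) (by positivity), div_rpow h1.le (by positivity), ← rpow_mul h1.le,
    ← rpow_mul h0.le, ← rpow_natCast ‖1 - conj w * z‖ 2, ← rpow_mul h0.le, div_mul_cancel₀ _ hp.ne',
    mul_assoc 2, div_mul_cancel₀ _ hp.ne']
  rfl

theorem differentiableOn_moebiusOp {w : ℂ} {κ : ℝ} {f : ℂ → ℂ} {s t : Set ℂ} (ht : IsOpen t)
    (hf : DifferentiableOn ℂ f t)
    (hs : ∀ z ∈ s, 0 < (1 - conj w * z).re ∧ discInvolution w z ∈ t) :
    DifferentiableOn ℂ (moebiusOp w κ f) s := by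
  intro z hz
  obtain ⟨h1, h2⟩ := hs z hz
  have h3 : DifferentiableAt ℂ (fun z => f (discInvolution w z)) z :=
    (hf.differentiableAt (ht.mem_nhds h2)).comp z (hasDerivAt_discInvolution h1).differentiableAt
  have h4 : DifferentiableAt ℂ (fun z => (1 - conj w * z) ^ ((2 * κ : ℝ) : ℂ)) z :=
    DifferentiableAt.cpow_const (by fun_prop) (Or.inl h1)
  refine (h3.mul ((differentiableAt_const _).div h4 ?_)).differentiableWithinAt
  rw [Complex.cpow_ne_zero_iff]
  exact Or.inl (ne_zero_of_re_pos h1)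

/-! ### Weighted area integrals and their invariance -/

theorem setIntegral_ball_eq_integral_circleAverage {α C : ℝ} (hα : 0 < α) {ψ : ℂ → ℝ}
    (hψ : ContinuousOn ψ (ball 0 1)) (hC : ∀ z ∈ ball (0 : ℂ) 1, |ψ z| ≤ C * (1 - ‖z‖)) :
    ∫ z in ball (0 : ℂ) 1, ψ z * (1 - ‖z‖ ^ 2) ^ (α - 2) =
      2 * π * ∫ ρ in (0 : ℝ)..1, circleAverage ψ 0 ρ * (ρ * (1 - ρ ^ 2) ^ (α - 2)) := by
  set k : ℝ × ℝ → ℝ := fun q => ψ (circleMap 0 q.1 q.2) * (q.1 * (1 - q.1 ^ 2) ^ (α - 2)) with hk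
  have hball : ∀ q ∈ Ioo (0 : ℝ) 1 ×ˢ Ioo (-π) π, circleMap 0 q.1 q.2 ∈ ball (0 : ℂ) 1 := by
    intro q hq
    rw [mem_ball_zero_iff, norm_circleMap_zero, abs_of_pos hq.1.1]
    exact hq.1.2
  have hint : IntegrableOn k (Ioo 0 1 ×ˢ Ioo (-π) π) (volume.prod volume) := by
    have h1 := intervalIntegrable_mul_one_sub_sq_rpow hα
    rw [intervalIntegrable_iff_integrableOn_Ioo_of_le zero_le_one] at h1
    have h2 : IntegrableOn (fun _ : ℝ => C) (Ioo (-π) π) :=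
      integrableOn_const (by simp)
    have h3 := Integrable.mul_prod h1 h2
    rw [Measure.prod_restrict] at h3
    refine h3.mono' (ContinuousOn.aestronglyMeasurable ?_ (measurableSet_Ioo.prod measurableSet_Ioo))
      ((ae_restrict_iff' (measurableSet_Ioo.prod measurableSet_Ioo)).2
        (Eventually.of_forall fun q hq => ?_))
    · refine (hψ.comp (by fun_prop) hball).mul (continuousOn_fst.mul
        (ContinuousOn.rpow_const (by fun_prop) fun q hq => Or.inl (one_sub_sq_pos hq.1).ne'))
    · have h4 := hC _ (hball q hq)
      rw [norm_circleMap_zero, abs_of_pos hq.1.1] at h4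
      have h5 : 0 ≤ q.1 * (1 - q.1 ^ 2) ^ (α - 2) :=
        mul_nonneg hq.1.1.le (rpow_nonneg (one_sub_sq_pos hq.1).le _)
      have hC0 : 0 ≤ C := nonneg_of_mul_nonneg_left ((abs_nonneg _).trans h4) (by linarith [hq.1.2])
      rw [hk, norm_mul, norm_eq_abs, norm_of_nonneg h5]
      calc |ψ (circleMap 0 q.1 q.2)| * (q.1 * (1 - q.1 ^ 2) ^ (α - 2))
          ≤ C * (1 - q.1) * (q.1 * (1 - q.1 ^ 2) ^ (α - 2)) := by gcongr
        _ = C * ((1 - q.1) * (q.1 * (1 - q.1 ^ 2) ^ (α - 2))) := by ring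
        _ ≤ C * (q.1 * (1 - q.1 ^ 2) ^ (α - 1)) :=
          mul_le_mul_of_nonneg_left (one_sub_mul_rpow_le hq.1) hC0
        _ = _ := mul_comm _ _
  rw [← integral_indicator measurableSet_ball, ← Complex.integral_comp_polarCoord_symm,
    polarCoord_target, setIntegral_eq_of_subset_of_forall_sdiff_eq_zero
      (measurableSet_Ioi.prod measurableSet_Ioo)
      (prod_mono_left Ioo_subset_Ioi_self : Ioo (0 : ℝ) 1 ×ˢ Ioo (-π) π ⊆ _)]
  · have hpc : ∀ q ∈ Ioo (0 : ℝ) 1 ×ˢ Ioo (-π) π,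
        q.1 • (ball (0 : ℂ) 1).indicator (fun z => ψ z * (1 - ‖z‖ ^ 2) ^ (α - 2))
          (Complex.polarCoord.symm q) = k q := by
      intro q hq
      have e : Complex.polarCoord.symm q = circleMap 0 q.1 q.2 := by
        rw [Complex.polarCoord_symm_apply, circleMap, zero_add, Complex.exp_mul_I]
        push_cast; ring
      rw [e, indicator_of_mem (hball q hq), norm_circleMap_zero, sq_abs, hk, smul_eq_mul]
      ring
    rw [setIntegral_congr_fun (measurableSet_Ioo.prod measurableSet_Ioo) hpc,
      Measure.volume_eq_prod, setIntegral_prod _ hint, ← intervalIntegral.integral_const_mul,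
      intervalIntegral.integral_of_le zero_le_one, integral_Ioc_eq_integral_Ioo]
    refine setIntegral_congr_fun measurableSet_Ioo fun ρ _ => ?_
    simp only [hk]
    rw [integral_mul_const, circleAverage_eq_integral_add (-π), ← integral_Ioc_eq_integral_Ioo,
      ← intervalIntegral.integral_of_le (by linarith [pi_pos]),
      intervalIntegral.integral_comp_add_right (fun θ => ψ (circleMap 0 ρ θ))]
    rw [smul_eq_mul, show 0 + -π = -π by ring, show 2 * π + -π = π by ring]
    field_simp
  · rintro q ⟨hq1, hq2⟩
    have : 1 ≤ q.1 := by
      by_contra! h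
      exact hq2 ⟨⟨hq1.1, h⟩, hq1.2⟩
    rw [indicator_of_notMem, smul_zero]
    rw [mem_ball_zero_iff, Complex.norm_polarCoord_symm, abs_of_pos hq1.1]
    linarith

/-- The area Jacobian `J²` and the factor `J^(α-2)` from `1 - |φ|² = J (1 - |z|²)` combine to `J^α`.
-/
theorem setIntegral_discInvolution {α : ℝ} {w : ℂ} (hw : ‖w‖ < 1) (g : ℂ → ℝ) :
    ∫ z in ball (0 : ℂ) 1, g (discInvolution w z) * discJacobian w z ^ α *
        (1 - ‖z‖ ^ 2) ^ (α - 2) =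
      ∫ z in ball (0 : ℂ) 1, g z * (1 - ‖z‖ ^ 2) ^ (α - 2) := by
  have hre : ∀ z ∈ ball (0 : ℂ) 1, 0 < (1 - conj w * z).re := fun z hz =>
    re_one_sub_conj_mul_pos hw (mem_ball_zero_iff.1 hz).le
  have hmaps : MapsTo (discInvolution w) (ball 0 1) (ball 0 1) := fun z hz => by
    rw [mem_ball_zero_iff] at hz ⊢
    exact norm_discInvolution_lt_one hw hz
  have hinv : ∀ z ∈ ball (0 : ℂ) 1, discInvolution w (discInvolution w z) = z := fun z hz =>
    discInvolution_discInvolution hw (hre z hz)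
  have himg : discInvolution w '' ball 0 1 = ball 0 1 :=
    hmaps.image_subset.antisymm fun z hz => ⟨_, hmaps hz, hinv z hz⟩
  have hinj : InjOn (discInvolution w) (ball 0 1) := LeftInvOn.injOn hinv
  conv_rhs => rw [← himg]
  rw [integral_image_eq_integral_abs_det_fderiv_smul volume measurableSet_ball
    (fun z hz => ((hasDerivAt_discInvolution (hre z hz)).hasFDerivAt.restrictScalars
      ℝ).hasFDerivWithinAt) hinj]
  refine setIntegral_congr_fun measurableSet_ball fun z hz => ?_
  have hJ := discJacobian_pos hw (hre z hz)
  have hd : 0 < 1 - ‖z‖ ^ 2 := one_sub_norm_sq_pos (mem_ball_zero_iff.1 hz)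
  -- The real determinant of multiplication by `a` is `‖a‖²`.
  have hdet : |((ContinuousLinearMap.toSpanSingleton ℂ
      (-((1 - ‖w‖ ^ 2 : ℝ) : ℂ) / (1 - conj w * z) ^ 2)).restrictScalars ℝ).det| =
      discJacobian w z ^ 2 := by
    rw [← norm_deriv_discInvolution hw]
    generalize -((1 - ‖w‖ ^ 2 : ℝ) : ℂ) / (1 - conj w * z) ^ 2 = a
    simp [ContinuousLinearMap.det, LinearMap.det_restrictScalars,
      Algebra.norm_complex_apply, Complex.normSq_eq_norm_sq]
  simp only [smul_eq_mul]
  rw [hdet, one_sub_norm_discInvolution_sq (hre z hz), mul_rpow hJ.le hd.le,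
    show discJacobian w z ^ α = discJacobian w z ^ 2 * discJacobian w z ^ (α - 2) by
      rw [← rpow_natCast, ← rpow_add hJ]; congr 1; push_cast; ring]
  ring

/-! ### Invariance for functions analytic across the circle -/

theorem meanFunctional_congr {α : ℝ} {m m' : ℝ → ℝ} (h : EqOn m m' (Icc 0 1)) :
    meanFunctional α m = meanFunctional α m' := by
  simp only [meanFunctional]
  rw [h ⟨zero_le_one, le_rfl⟩]
  congr 2
  refine intervalIntegral.integral_congr fun ρ hρ => ?_
  rw [uIcc_of_le zero_le_one] at hρ
  simp only [h hρ]

theorem meanFunctional_const (α c : ℝ) : meanFunctional α (fun _ => c) = c := by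
  simp [meanFunctional]

/-- A continuous function on the closed disc that vanishes on the circle and is locally Lipschitz
there is dominated by the distance to the circle. -/
theorem exists_abs_le_mul_one_sub_norm {g : ℂ → ℝ} (hg : ContinuousOn g (closedBall 0 1))
    (h0 : ∀ z, ‖z‖ = 1 → g z = 0)
    (hlip : ∀ z, ‖z‖ = 1 → ∃ K, ∃ t ∈ 𝓝 z, LipschitzOnWith K g t) :
    ∃ C, ∀ z ∈ closedBall (0 : ℂ) 1, |g z| ≤ C * (1 - ‖z‖) := by
  refine (isCompact_closedBall (0 : ℂ) 1).induction_on
    (p := fun s => ∃ C, ∀ z ∈ s, z ∈ closedBall (0 : ℂ) 1 → |g z| ≤ C * (1 - ‖z‖))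
    ⟨0, by simp⟩ (fun s t hst ⟨C, hC⟩ => ⟨C, fun z hz => hC z (hst hz)⟩) ?_ ?_ |>.imp
    fun C hC z hz => hC z hz hz
  · rintro s t ⟨C, hC⟩ ⟨C', hC'⟩
    refine ⟨max C C', fun z hz hzb => ?_⟩
    have h1 : 0 ≤ 1 - ‖z‖ := sub_nonneg.2 (mem_closedBall_zero_iff.1 hzb)
    rcases hz with hz | hz
    · exact (hC z hz hzb).trans (mul_le_mul_of_nonneg_right (le_max_left _ _) h1)
    · exact (hC' z hz hzb).trans (mul_le_mul_of_nonneg_right (le_max_right _ _) h1)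
  · intro x hx
    rcases (mem_closedBall_zero_iff.1 hx).lt_or_eq with h | h
    · obtain ⟨B, hB⟩ := (isCompact_closedBall (0 : ℂ) 1).exists_bound_of_continuousOn hg
      refine ⟨{z | ‖z‖ < (‖x‖ + 1) / 2}, mem_nhdsWithin_of_mem_nhds
        ((isOpen_lt continuous_norm continuous_const).mem_nhds (show ‖x‖ < _ by linarith)),
        B * (2 / (1 - ‖x‖)), fun z hz hzb => (hB z hzb).trans ?_⟩
      have hB0 : 0 ≤ B := (norm_nonneg _).trans (hB z hzb)
      rw [mul_assoc]
      refine le_mul_of_one_le_right hB0 ?_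
      rw [div_mul_eq_mul_div, one_le_div (by linarith)]
      have : ‖z‖ < (‖x‖ + 1) / 2 := hz
      linarith
    · obtain ⟨K, t, ht, hK⟩ := hlip x h
      have hx0 : ‖x‖ ≠ 0 := by rw [h]; exact one_ne_zero
      -- Each nearby `z` is compared with its radial projection `z / ‖z‖`, where `g` vanishes; the
      -- projection must also land in `t`.
      have hc : ContinuousAt (fun z : ℂ => (‖z‖ : ℂ)⁻¹ * z) x := by
        refine ContinuousAt.mul (ContinuousAt.inv₀ (by fun_prop) (by exact_mod_cast hx0))
          continuousAt_id
      have ht' : (fun z : ℂ => (‖z‖ : ℂ)⁻¹ * z) ⁻¹' t ∈ 𝓝 x := hc (by simpa [h] using ht)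
      have hne : {z : ℂ | z ≠ 0} ∈ 𝓝 x := isOpen_ne.mem_nhds (norm_ne_zero_iff.1 hx0)
      refine ⟨_, mem_nhdsWithin_of_mem_nhds (inter_mem (inter_mem ht ht') hne), K,
        fun z hz hzb => ?_⟩
      have hz0 : 0 < ‖z‖ := norm_pos_iff.2 hz.2
      have h1 := hK.dist_le_mul z hz.1.1 _ hz.1.2
      rw [h0 ((‖z‖ : ℂ)⁻¹ * z) (by simp [hz0.ne']), Real.dist_eq, sub_zero, dist_eq_norm] at h1
      have e : z - (‖z‖ : ℂ)⁻¹ * z = ((‖z‖⁻¹ * (‖z‖ - 1) : ℝ) : ℂ) * z := by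
        have : (‖z‖ : ℂ) ≠ 0 := by exact_mod_cast hz0.ne'
        push_cast; field_simp
      rw [e, norm_mul, Complex.norm_real, norm_mul, norm_inv, norm_norm, norm_eq_abs, abs_sub_comm,
        abs_of_nonneg (sub_nonneg.2 (mem_closedBall_zero_iff.1 hzb))] at h1
      refine h1.trans_eq ?_
      field_simp

/-- The bound `hC` forces `W = ‖F‖^p` on the circle, so the boundary terms agree. What remains is a
radial integral of the difference, rewritten over the disc in polar coordinates. -/
theorem meanFunctional_circleAverage_eq {α p R C : ℝ} (hα : 0 < α) (hp : 0 < p) (hR : 1 < R)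
    {F : ℂ → ℂ} (hF : DifferentiableOn ℂ F (ball 0 R)) {W : ℂ → ℝ}
    (hW : ContinuousOn W (closedBall 0 1))
    (hC : ∀ z ∈ closedBall (0 : ℂ) 1, |W z - ‖F z‖ ^ p| ≤ C * (1 - ‖z‖)) :
    meanFunctional α (circleAverage W 0) = meanFunctional α (integralMean p F) -
      (1 - α) / π * ∫ z in ball (0 : ℂ) 1, (W z - ‖F z‖ ^ p) * (1 - ‖z‖ ^ 2) ^ (α - 2) := by
  have hu : ContinuousOn (fun z => ‖F z‖ ^ p) (closedBall 0 1) :=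
    continuousOn_norm_rpow hp (hF.continuousOn.mono (closedBall_subset_ball hR))
  have hψ : ContinuousOn (fun z => W z - ‖F z‖ ^ p) (closedBall 0 1) := hW.sub hu
  have hsph : ∀ ρ ∈ Icc (0 : ℝ) 1, sphere (0 : ℂ) ρ ⊆ closedBall 0 1 := fun ρ hρ =>
    sphere_subset_closedBall.trans (closedBall_subset_closedBall hρ.2)
  have havg : ∀ ρ ∈ Icc (0 : ℝ) 1, circleAverage (fun z => W z - ‖F z‖ ^ p) 0 ρ =
      circleAverage W 0 ρ - integralMean p F ρ := fun ρ hρ =>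
    circleAverage_fun_sub ((hW.mono (hsph ρ hρ)).circleIntegrable hρ.1)
      ((hu.mono (hsph ρ hρ)).circleIntegrable hρ.1)
  have havgC : ∀ ρ ∈ Icc (0 : ℝ) 1,
      |circleAverage (fun z => W z - ‖F z‖ ^ p) 0 ρ| ≤ C * (1 - ρ) := fun ρ hρ => by
    refine abs_circleAverage_le_circleAverage_abs.trans (circleAverage_mono_on_of_le_circle
      ((hψ.abs.mono (hsph ρ hρ)).circleIntegrable hρ.1) fun z hz => ?_)
    rw [abs_of_nonneg hρ.1] at hz
    have := hC z (hsph ρ hρ hz)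
    rwa [mem_sphere_zero_iff_norm.1 hz] at this
  have hsub : Icc (0 : ℝ) 1 ⊆ Ico 0 R := fun x hx => ⟨hx.1, hx.2.trans_lt hR⟩
  have hmc := (continuousOn_integralMean hp hF.continuousOn).mono hsub
  obtain ⟨C', hC'⟩ := exists_one_sub_le_of_convexOn (log_pos hR)
    ((monotoneOn_integralMean hp hF).mono hsub)
    (convexOn_integralMean_exp hp (by linarith) hF)
  have hac : ContinuousOn (circleAverage (fun z => W z - ‖F z‖ ^ p) 0) (Icc 0 1) := by
    refine ContinuousOn.circleAverage (hψ.mono fun z hz => ?_) fun r hr => hr.1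
    have : ‖z - 0‖ ∈ Icc (0 : ℝ) 1 := hz
    rw [sub_zero] at this
    simpa using this.2
  have hi1 := intervalIntegrable_mul_mul_one_sub_sq_rpow (g := fun ρ => integralMean p F 1 -
      integralMean p F ρ) hα (continuousOn_const.sub (hmc.mono Ioo_subset_Icc_self))
    fun ρ hρ => hC' ρ (Ioo_subset_Icc_self hρ)
  have hi2 := intervalIntegrable_mul_mul_one_sub_sq_rpow hα (hac.mono Ioo_subset_Icc_self)
    fun ρ hρ => havgC ρ (Ioo_subset_Icc_self hρ)
  have h1 : circleAverage W 0 1 = integralMean p F 1 := by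
    have := havgC 1 ⟨zero_le_one, le_rfl⟩
    rw [sub_self, mul_zero, abs_nonpos_iff, havg 1 ⟨zero_le_one, le_rfl⟩] at this
    linarith
  rw [setIntegral_ball_eq_integral_circleAverage hα (hψ.mono ball_subset_closedBall)
    fun z hz => hC z (ball_subset_closedBall hz)]
  have hsplit : (∫ ρ in (0 : ℝ)..1, (circleAverage W 0 1 - circleAverage W 0 ρ) *
        (ρ * (1 - ρ ^ 2) ^ (α - 2))) =
      (∫ ρ in (0 : ℝ)..1, (integralMean p F 1 - integralMean p F ρ) *
        (ρ * (1 - ρ ^ 2) ^ (α - 2))) -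
      ∫ ρ in (0 : ℝ)..1, circleAverage (fun z => W z - ‖F z‖ ^ p) 0 ρ *
        (ρ * (1 - ρ ^ 2) ^ (α - 2)) := by
    rw [← intervalIntegral.integral_sub hi1 hi2]
    refine intervalIntegral.integral_congr fun ρ hρ => ?_
    rw [uIcc_of_le zero_le_one] at hρ
    simp only [havg ρ hρ, h1]
    ring
  simp only [meanFunctional]
  rw [hsplit, h1]
  have := pi_ne_zero
  field_simp
  ring

theorem discJacobian_rpow_eq {w z : ℂ} (hw : ‖w‖ < 1) (hz : 0 < (1 - conj w * z).re) (α : ℝ) :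
    ((discJacobian w z ^ α : ℝ) : ℂ) = (((1 - ‖w‖ ^ 2) ^ α : ℝ) : ℂ) / (1 - conj w * z) ^ (α : ℂ) *
      (1 / (1 - w * conj z) ^ (α : ℂ)) := by
  have h0 : 0 < ‖1 - conj w * z‖ := norm_pos_iff.2 (ne_zero_of_re_pos hz)
  have hc : (1 - w * conj z) ^ (α : ℂ) = conj ((1 - conj w * z) ^ (α : ℂ)) := by
    have harg : (1 - conj w * z).arg ≠ π :=
      (Complex.mem_slitPlane_iff_arg.1 (Or.inl hz)).1
    have h := Complex.cpow_conj (1 - conj w * z) (α : ℂ) harg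
    have h2 := Complex.conj_cpow (1 - conj w * z) (α : ℂ) harg
    rw [Complex.conj_ofReal] at h2
    rw [← h2]
    simp
  rw [hc, div_mul_div_comm, mul_one, Complex.mul_conj, Complex.normSq_eq_norm_sq,
    Complex.norm_cpow_real, discJacobian, div_rpow (one_sub_norm_sq_pos hw).le (by positivity)]
  push_cast
  congr 1
  norm_cast
  rw [← rpow_natCast, ← rpow_natCast, ← rpow_mul h0.le, ← rpow_mul h0.le, mul_comm α]

/-- The analytic factor of `J^α` is absorbed into `F`; the remaining factor is the reproducing
kernel, which evaluates `F` at `w`. The involution sends `w` to `0`, and the absorbed factor equals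
`1` there. -/
theorem meanFunctional_re_discInvolution {α R : ℝ} (hα : 0 < α) (hR : 1 < R) {H : ℂ → ℂ}
    (hH : DifferentiableOn ℂ H (ball 0 R)) {w : ℂ} (hw : ‖w‖ < 1) :
    meanFunctional α (circleAverage (fun z => (H (discInvolution w z)).re * discJacobian w z ^ α) 0)
      = (H 0).re := by
  obtain ⟨R', hR', hball⟩ := exists_radius_discInvolution hw hR
  set F : ℂ → ℂ := fun z => H (discInvolution w z) *
    ((((1 - ‖w‖ ^ 2) ^ α : ℝ) : ℂ) / (1 - conj w * z) ^ (α : ℂ)) with hFdef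
  have hF : DifferentiableOn ℂ F (ball 0 R') := by
    intro z hz
    obtain ⟨h1, h2⟩ := hball z hz
    refine (((hH.differentiableAt (isOpen_ball.mem_nhds h2)).comp z
      (hasDerivAt_discInvolution h1).differentiableAt).mul ((differentiableAt_const _).div
        (DifferentiableAt.cpow_const (by fun_prop) (Or.inl h1)) ?_)).differentiableWithinAt
    rw [Complex.cpow_ne_zero_iff]
    exact Or.inl (ne_zero_of_re_pos h1)
  have hker := meanFunctional_mul_kernel hα hR' hF hw
  have hFw : F w = H 0 := by
    have h1 : (1 - conj w * w) = ((1 - ‖w‖ ^ 2 : ℝ) : ℂ) := by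
      push_cast; rw [← Complex.conj_mul']
    have h2 := one_sub_norm_sq_pos hw
    simp only [hFdef, discInvolution_self, h1]
    rw [← Complex.ofReal_cpow h2.le, div_self, mul_one]
    exact_mod_cast (rpow_pos_of_pos h2 α).ne'
  rw [hFw] at hker
  rw [← hker]
  refine meanFunctional_congr fun ρ hρ => ?_
  have hle : ∀ z ∈ sphere (0 : ℂ) ρ, 0 < (1 - conj w * z).re ∧ z ∈ ball (0 : ℂ) R' := by
    intro z hz
    rw [mem_sphere_zero_iff_norm] at hz
    have : z ∈ ball (0 : ℂ) R' := by rw [mem_ball_zero_iff, hz]; exact hρ.2.trans_lt hR'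
    exact ⟨(hball z this).1, this⟩
  have hint : CircleIntegrable (fun z => F z * (1 / (1 - w * conj z) ^ (α : ℂ))) 0 ρ := by
    refine ContinuousOn.circleIntegrable hρ.1 ((hF.continuousOn.mono fun z hz => (hle z hz).2).mul
      (continuousOn_const.div ?_ ?_))
    · refine ContinuousOn.cpow_const (by fun_prop) fun z hz => Or.inl ?_
      have := (hle z hz).1
      simpa using this
    · intro z hz
      rw [Complex.cpow_ne_zero_iff]
      refine Or.inl (ne_zero_of_re_pos ?_)
      have := (hle z hz).1
      simpa using this
  have hcomm := Complex.reCLM.circleAverage_comp_comm hint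
  simp only [Complex.reCLM_apply] at hcomm
  rw [← hcomm]
  refine circleAverage_congr_sphere fun z hz => ?_
  rw [abs_of_nonneg hρ.1] at hz
  simp only [Function.comp_apply, Complex.reCLM_apply, hFdef]
  rw [mul_assoc, ← discJacobian_rpow_eq hw (hle z hz).1, Complex.re_mul_ofReal]

/-- The invariance of the norm for functions that are analytic across the unit circle. -/
theorem dirichletNorm_moebiusOp_of_ball {α p R : ℝ} (hα : 0 < α) (hp : 0 < p) (hR : 1 < R)
    {f : ℂ → ℂ} (hf : DifferentiableOn ℂ f (ball 0 R)) (hne : ∀ z, ‖z‖ = 1 → f z ≠ 0) {w : ℂ}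
    (hw : ‖w‖ < 1) : dirichletNorm α p (moebiusOp w (α / p) f) = dirichletNorm α p f := by
  obtain ⟨R', hR', hball⟩ := exists_radius_discInvolution hw hR
  have hT : DifferentiableOn ℂ (moebiusOp w (α / p) f) (ball 0 R') :=
    differentiableOn_moebiusOp isOpen_ball hf hball
  rw [dirichletNorm_eq_meanFunctional hα hp hR hf, dirichletNorm_eq_meanFunctional hα hp hR' hT]
  congr 2
  obtain ⟨H, r, hr, hH, hHre⟩ := exists_re_eq_norm_rpow (p := p) hR hf hne
  have hre : ∀ z ∈ closedBall (0 : ℂ) 1, 0 < (1 - conj w * z).re := fun z hz =>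
    re_one_sub_conj_mul_pos hw (mem_closedBall_zero_iff.1 hz)
  have hmaps : MapsTo (discInvolution w) (closedBall 0 1) (closedBall 0 1) := fun z hz => by
    rw [mem_closedBall_zero_iff] at hz ⊢
    exact norm_discInvolution_le_one hw hz
  have hHc : ContinuousOn (fun z => (H z).re) (closedBall 0 1) :=
    Complex.continuous_re.comp_continuousOn (hH.continuousOn.mono (closedBall_subset_ball hr))
  have hφc : ContinuousOn (discInvolution w) (closedBall 0 1) := fun z hz =>
    (hasDerivAt_discInvolution (hre z hz)).continuousAt.continuousWithinAt
  have hJc : ContinuousOn (discJacobian w) (closedBall 0 1) := by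
    refine continuousOn_const.div (by fun_prop) fun z hz => ?_
    exact pow_ne_zero 2 (norm_ne_zero_iff.2 (ne_zero_of_re_pos (hre z hz)))
  have hJαc : ContinuousOn (fun z => discJacobian w z ^ α) (closedBall 0 1) :=
    hJc.rpow_const fun _ _ => Or.inr hα.le
  set g : ℂ → ℝ := fun z => (H z).re - ‖f z‖ ^ p with hg
  obtain ⟨C, hC⟩ : ∃ C, ∀ z ∈ closedBall (0 : ℂ) 1, |g z| ≤ C * (1 - ‖z‖) := by
    refine exists_abs_le_mul_one_sub_norm (hHc.sub (continuousOn_norm_rpow hp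
      (hf.continuousOn.mono (closedBall_subset_ball hR)))) (fun z hz => ?_) fun z hz => ?_
    · exact sub_eq_zero.2 (hHre z hz)
    -- Since `f` has no zero on the circle, `‖f‖^p` is smooth near it, even for small `p`.
    · refine ContDiffAt.exists_lipschitzOnWith (𝕂 := ℝ) (f := g) ?_
      have h1 : ContDiffAt ℝ 1 H z := ((hH.analyticAt (isOpen_ball.mem_nhds (by
        rw [mem_ball_zero_iff, hz]; exact hr))).contDiffAt).restrict_scalars ℝ
      have h2 : ContDiffAt ℝ 1 f z := ((hf.analyticAt (isOpen_ball.mem_nhds (by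
        rw [mem_ball_zero_iff, hz]; exact hR))).contDiffAt).restrict_scalars ℝ
      exact (Complex.reCLM.contDiff.contDiffAt.comp z h1).sub
        ((h2.norm ℝ (hne z hz)).rpow_const_of_ne (norm_ne_zero_iff.2 (hne z hz)))
  obtain ⟨B, hB⟩ := (isCompact_closedBall (0 : ℂ) 1).exists_bound_of_continuousOn (hJαc.mul hJc)
  have hTg : ∀ z ∈ closedBall (0 : ℂ) 1,
      (H (discInvolution w z)).re * discJacobian w z ^ α - ‖moebiusOp w (α / p) f z‖ ^ p =
        g (discInvolution w z) * discJacobian w z ^ α := fun z hz => by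
    rw [norm_moebiusOp_rpow hw hp (hre z hz)]
    simp only [hg]
    ring
  have hC0 : 0 ≤ C := by
    have := hC 0 (by simp)
    rw [norm_zero, sub_zero, mul_one] at this
    exact (abs_nonneg _).trans this
  have hTC : ∀ z ∈ closedBall (0 : ℂ) 1,
      |(H (discInvolution w z)).re * discJacobian w z ^ α - ‖moebiusOp w (α / p) f z‖ ^ p| ≤
        (2 * C * B) * (1 - ‖z‖) := fun z hz => by
    have hJ := discJacobian_pos hw (hre z hz)
    have h1 := hC _ (hmaps hz)
    have h2 : ‖discJacobian w z ^ α * discJacobian w z‖ ≤ B := hB z hz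
    have h3 := one_sub_norm_discInvolution_sq (hre z hz)
    have h4 := mem_closedBall_zero_iff.1 (hmaps hz)
    have h5 := mem_closedBall_zero_iff.1 hz
    -- From `1 - |φ| ≤ 1 - |φ|² = J (1 - |z|²) ≤ 2 J (1 - |z|)`.
    have h6 : 1 - ‖discInvolution w z‖ ≤ 2 * discJacobian w z * (1 - ‖z‖) := by
      nlinarith [norm_nonneg (discInvolution w z), norm_nonneg z,
        mul_nonneg hJ.le (mul_nonneg (sub_nonneg.2 h5) (sub_nonneg.2 h5))]
    have hJα := rpow_nonneg hJ.le α
    rw [norm_of_nonneg (mul_nonneg hJα hJ.le)] at h2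
    rw [hTg z hz, abs_mul, abs_of_nonneg hJα]
    calc |g (discInvolution w z)| * discJacobian w z ^ α
        ≤ C * (2 * discJacobian w z * (1 - ‖z‖)) * discJacobian w z ^ α := by
          refine mul_le_mul_of_nonneg_right (h1.trans ?_) hJα
          exact mul_le_mul_of_nonneg_left h6 hC0
      _ = 2 * C * (discJacobian w z ^ α * discJacobian w z) * (1 - ‖z‖) := by ring
      _ ≤ _ := by
        refine mul_le_mul_of_nonneg_right ?_ (sub_nonneg.2 h5)
        exact mul_le_mul_of_nonneg_left h2 (by positivity)
  have e1 := meanFunctional_circleAverage_eq hα hp hR hf hHc hC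
  have e2 := meanFunctional_circleAverage_eq hα hp hR' hT
    ((hHc.comp hφc hmaps).mul hJαc) hTC
  have e3 : meanFunctional α (circleAverage (fun z => (H z).re) 0) = (H 0).re := by
    rw [← meanFunctional_const α (H 0).re]
    refine meanFunctional_congr fun ρ hρ => ?_
    have hb : closedBall (0 : ℂ) |ρ| ⊆ ball 0 r := closedBall_subset_ball (by
      rw [abs_of_nonneg hρ.1]; exact hρ.2.trans_lt hr)
    have hcomm := Complex.reCLM.circleAverage_comp_comm (f := H) (c := 0) (R := ρ)
      (hH.continuousOn.mono (sphere_subset_closedBall.trans hb)).circleIntegrable'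
    have hm := DiffContOnCl.circleAverage (f := H) (c := 0) (R := ρ)
      (DifferentiableOn.diffContOnCl (hH.mono (closure_ball_subset_closedBall.trans hb)))
    rw [hm] at hcomm
    exact hcomm
  have e4 := meanFunctional_re_discInvolution hα hr hH hw
  have e5 := setIntegral_discInvolution (α := α) hw g
  rw [e3] at e1
  have e6 : (∫ z in ball (0 : ℂ) 1, ((H (discInvolution w z)).re * discJacobian w z ^ α -
      ‖moebiusOp w (α / p) f z‖ ^ p) * (1 - ‖z‖ ^ 2) ^ (α - 2)) =
      ∫ z in ball (0 : ℂ) 1, g z * (1 - ‖z‖ ^ 2) ^ (α - 2) := by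
    rw [← e5]
    refine setIntegral_congr_fun measurableSet_ball fun z hz => ?_
    simp only [hTg z (ball_subset_closedBall hz)]
  simp only [Pi.mul_apply, Function.comp_apply] at e2
  rw [e6] at e2
  have e7 := e4.symm.trans e2
  linarith

/-! ### Dilation, lower semicontinuity and the general case -/

theorem dirichletNorm_congr {α p : ℝ} {f g : ℂ → ℂ} (h : ∀ z ∈ ball (0 : ℂ) 1, ‖f z‖ = ‖g z‖) :
    dirichletNorm α p f = dirichletNorm α p g := by
  have hm : EqOn (integralMean p f) (integralMean p g) (Ioo (-1) 1) := fun r hr => by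
    refine circleAverage_congr_sphere fun z hz => ?_
    have : z ∈ ball (0 : ℂ) 1 := by
      rw [mem_sphere_zero_iff_norm] at hz
      rw [mem_ball_zero_iff, hz]
      exact abs_lt.2 hr
    simp only [h z this]
  rw [dirichletNorm, dirichletNorm, h 0 (by simp)]
  congr 2
  refine setLIntegral_congr_fun measurableSet_Ioo fun r hr => ?_
  have hd : integralMean p f =ᶠ[𝓝 r] integralMean p g :=
    hm.eventuallyEq_of_mem (Ioo_mem_nhds (by linarith [hr.1]) hr.2)
  simp only [hd.deriv_eq]

theorem integralMean_comp_mul (p : ℝ) (f : ℂ → ℂ) (R r : ℝ) :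
    integralMean p (fun z => f (R * z)) r = integralMean p f (R * r) := by
  simp only [integralMean, circleAverage_def]
  congr 2
  ext θ
  simp only [circleMap, zero_add]
  push_cast
  ring_nf

/-- `r * m'(r)` is the derivative of `m` with respect to `log r`, and convexity makes it increasing.
-/
theorem mul_deriv_le_mul_deriv {m : ℝ → ℝ} (hconv : ConvexOn ℝ (Iio 0) (fun t => m (exp t)))
    {r s : ℝ} (hr : 0 < r) (hrs : r < s) (hs : s < 1) (hmr : DifferentiableAt ℝ m r)
    (hms : DifferentiableAt ℝ m s) : deriv m r * r ≤ deriv m s * s := by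
  have hexp : ∀ x, 0 < x → DifferentiableAt ℝ m x →
      HasDerivAt (fun t => m (exp t)) (deriv m x * x) (log x) := by
    intro x hx hm
    have h1 : HasDerivAt m (deriv m x) (exp (log x)) := by rw [exp_log hx]; exact hm.hasDerivAt
    have h2 := h1.comp (log x) (hasDerivAt_exp (log x))
    rwa [exp_log hx] at h2
  have hl := log_lt_log hr hrs
  have h0 : log s < 0 := log_neg (hr.trans hrs) hs
  exact (hconv.le_slope_of_hasDerivAt (hl.trans h0) h0 hl (hexp r hr hmr)).trans
    (hconv.slope_le_of_hasDerivAt (hl.trans h0) h0 hl (hexp s (hr.trans hrs) hms))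

theorem ae_differentiableAt_of_monotoneOn {m : ℝ → ℝ} (hm : MonotoneOn m (Ico 0 1)) :
    ∀ᵐ r ∂(volume.restrict (Ioo (0 : ℝ) 1)), DifferentiableAt ℝ m r := by
  filter_upwards [(hm.mono Ioo_subset_Ico_self).ae_differentiableWithinAt measurableSet_Ioo,
    ae_restrict_mem measurableSet_Ioo] with r hr hmem
  exact hr.differentiableAt (isOpen_Ioo.mem_nhds hmem)

theorem deriv_nonneg_of_monotoneOn {m : ℝ → ℝ} (hm : MonotoneOn m (Ico 0 1)) {r : ℝ}
    (hr : r ∈ Ioo (0 : ℝ) 1) : 0 ≤ deriv m r := by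
  have h := hm.derivWithin_nonneg (x := r)
  rwa [derivWithin_of_mem_nhds (Ico_mem_nhds hr.1 hr.2)] at h

/-- The `p`-th power of `dirichletNorm`. -/
noncomputable def dirichletEnergy (α p : ℝ) (f : ℂ → ℂ) : ℝ≥0∞ :=
  ENNReal.ofReal (‖f 0‖ ^ p) + ∫⁻ r in Ioo (0 : ℝ) 1,
    ENNReal.ofReal (deriv (integralMean p f) r * (1 - r ^ 2) ^ (α - 1))

theorem convexOn_integralMean_exp_unit {f : ℂ → ℂ} {p : ℝ} (hp : 0 < p)
    (hf : DifferentiableOn ℂ f (ball 0 1)) :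
    ConvexOn ℝ (Iio 0) (fun t => integralMean p f (exp t)) := by
  have := convexOn_integralMean_exp hp one_pos hf
  rwa [log_one] at this

theorem dirichletEnergy_comp_mul_le {α p R : ℝ} (hp : 0 < p) {f : ℂ → ℂ}
    (hf : DifferentiableOn ℂ f (ball 0 1)) (hR0 : 0 < R) (hR : R < 1) :
    dirichletEnergy α p (fun z => f (R * z)) ≤ dirichletEnergy α p f := by
  have hmono := monotoneOn_integralMean hp hf
  have e : integralMean p (fun z => f (R * z)) = fun r => integralMean p f (R * r) :=
    funext (integralMean_comp_mul p f R)
  simp only [dirichletEnergy, mul_zero, e]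
  refine add_le_add le_rfl (lintegral_mono_ae ?_)
  filter_upwards [ae_differentiableAt_of_monotoneOn hmono, ae_restrict_mem measurableSet_Ioo]
    with r hd hr
  refine ENNReal.ofReal_le_ofReal
    (mul_le_mul_of_nonneg_right ?_ (rpow_nonneg (one_sub_sq_pos hr).le _))
  rw [deriv_comp_mul_left, smul_eq_mul]
  have hn := deriv_nonneg_of_monotoneOn hmono hr
  have hlt : R * r < r := mul_lt_of_lt_one_left hr.1 hR
  by_cases hd' : DifferentiableAt ℝ (integralMean p f) (R * r)
  · have := mul_deriv_le_mul_deriv (convexOn_integralMean_exp_unit hp hf) (mul_pos hR0 hr.1)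
      hlt hr.2 hd' hd
    refine le_of_mul_le_mul_right ?_ hr.1
    linarith
  -- Where the derivative at `R * r` fails to exist, `deriv` is `0` and the bound is mere
  -- nonnegativity.
  · rw [deriv_zero_of_not_differentiableAt hd', mul_zero]
    exact hn

/-- By convexity each left slope of `M n` in `log r` is at most its derivative. Let `n → ∞` with the
slope's endpoint fixed, then let that endpoint tend to `log r`. -/
theorem ofReal_deriv_le_liminf {m : ℝ → ℝ} {M : ℕ → ℝ → ℝ} {r D : ℝ} (hr : r ∈ Ioo (0 : ℝ) 1)
    (hD : 0 ≤ D) (hconv : ∀ n, ConvexOn ℝ (Iio 0) (fun t => M n (exp t)))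
    (hM : ∀ n, DifferentiableAt ℝ (M n) r) (hm : DifferentiableAt ℝ m r)
    (hlim : ∀ s ∈ Ioo (0 : ℝ) 1, Tendsto (fun n => M n s) atTop (𝓝 (m s))) :
    ENNReal.ofReal (deriv m r * D) ≤
      liminf (fun n => ENNReal.ofReal (deriv (M n) r * D)) atTop := by
  have hl0 : log r < 0 := log_neg hr.1 hr.2
  have hexp : ∀ h : ℝ → ℝ, DifferentiableAt ℝ h r →
      HasDerivAt (fun t => h (exp t)) (deriv h r * r) (log r) := by
    intro h hd
    have h1 : HasDerivAt h (deriv h r) (exp (log r)) := by rw [exp_log hr.1]; exact hd.hasDerivAt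
    have h2 := h1.comp (log r) (hasDerivAt_exp (log r))
    rwa [exp_log hr.1] at h2
  have hslope : ∀ t < log r, ENNReal.ofReal (slope (fun t => m (exp t)) (log r) t * (r⁻¹ * D)) ≤
      liminf (fun n => ENNReal.ofReal (deriv (M n) r * D)) atTop := by
    intro t ht
    have htend : Tendsto (fun n => ENNReal.ofReal
        (slope (fun t => M n (exp t)) (log r) t * (r⁻¹ * D))) atTop
        (𝓝 (ENNReal.ofReal (slope (fun t => m (exp t)) (log r) t * (r⁻¹ * D)))) := by
      refine ENNReal.tendsto_ofReal (Tendsto.mul_const _ ?_)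
      simp only [slope_def_field]
      refine Tendsto.div_const (Tendsto.sub (hlim _ ⟨exp_pos t, ?_⟩) (hlim _ ?_)) _
      · rw [exp_lt_one_iff]; exact ht.trans hl0
      · rw [exp_log hr.1]; exact hr
    rw [← htend.liminf_eq]
    refine liminf_le_liminf (Eventually.of_forall fun n => ENNReal.ofReal_le_ofReal ?_)
    have := (hconv n).slope_le_of_hasDerivAt (ht.trans hl0) hl0 ht (hexp (M n) (hM n))
    rw [slope_comm] at this
    calc _ ≤ deriv (M n) r * r * (r⁻¹ * D) :=
          mul_le_mul_of_nonneg_right this (mul_nonneg (inv_pos.2 hr.1).le hD)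
      _ = _ := by have := hr.1.ne'; field_simp
  have hs : Tendsto (slope (fun t => m (exp t)) (log r)) (𝓝[<] (log r)) (𝓝 (deriv m r * r)) :=
    (hasDerivAt_iff_tendsto_slope.1 (hexp m hm)).mono_left
      (nhdsWithin_mono _ fun x hx => ne_of_lt hx)
  have hfin : Tendsto (fun t => ENNReal.ofReal
      (slope (fun t => m (exp t)) (log r) t * (r⁻¹ * D))) (𝓝[<] (log r))
      (𝓝 (ENNReal.ofReal (deriv m r * D))) := by
    refine ENNReal.tendsto_ofReal ?_
    have := hs.mul_const (r⁻¹ * D)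
    rwa [show deriv m r * r * (r⁻¹ * D) = deriv m r * D by
      have := hr.1.ne'; field_simp] at this
  refine le_of_tendsto hfin ?_
  filter_upwards [self_mem_nhdsWithin] with t ht using hslope t ht

/-- Fatou's lemma, fed by the pointwise bound `ofReal_deriv_le_liminf`. -/
theorem dirichletEnergy_le_of_tendsto {α p : ℝ} (hp : 0 < p) {F : ℂ → ℂ} {G : ℕ → ℂ → ℂ} {E : ℝ≥0∞}
    (hF : DifferentiableOn ℂ F (ball 0 1)) (hG : ∀ n, DifferentiableOn ℂ (G n) (ball 0 1))
    (h0 : Tendsto (fun n => G n 0) atTop (𝓝 (F 0)))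
    (hlim : ∀ r ∈ Ioo (0 : ℝ) 1,
      Tendsto (fun n => integralMean p (G n) r) atTop (𝓝 (integralMean p F r)))
    (hE : ∀ n, dirichletEnergy α p (G n) ≤ E) : dirichletEnergy α p F ≤ E := by
  set I : ℕ → ℝ → ℝ≥0∞ := fun n r =>
    ENNReal.ofReal (deriv (integralMean p (G n)) r * (1 - r ^ 2) ^ (α - 1)) with hI
  have ha : Tendsto (fun n => ENNReal.ofReal (‖G n 0‖ ^ p)) atTop
      (𝓝 (ENNReal.ofReal (‖F 0‖ ^ p))) :=
    ENNReal.tendsto_ofReal (h0.norm.rpow_const (Or.inr hp.le))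
  have haE : ENNReal.ofReal (‖F 0‖ ^ p) ≤ E :=
    le_of_tendsto ha (Eventually.of_forall fun n => le_self_add.trans (hE n))
  have hIE : ∫⁻ r in Ioo (0 : ℝ) 1,
      ENNReal.ofReal (deriv (integralMean p F) r * (1 - r ^ 2) ^ (α - 1)) ≤
        E - ENNReal.ofReal (‖F 0‖ ^ p) := by
    calc _ ≤ ∫⁻ r in Ioo (0 : ℝ) 1, liminf (fun n => I n r) atTop := by
          refine lintegral_mono_ae ?_
          filter_upwards [ae_differentiableAt_of_monotoneOn (monotoneOn_integralMean hp hF),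
            ae_all_iff.2 fun n =>
              ae_differentiableAt_of_monotoneOn (monotoneOn_integralMean hp (hG n)),
            ae_restrict_mem measurableSet_Ioo] with r h1 h2 hr
          exact ofReal_deriv_le_liminf hr (rpow_nonneg (one_sub_sq_pos hr).le _)
            (fun n => convexOn_integralMean_exp_unit hp (hG n)) h2 h1 hlim
      _ ≤ liminf (fun n => ∫⁻ r in Ioo (0 : ℝ) 1, I n r) atTop := by
          refine lintegral_liminf_le fun n => ?_
          exact ((measurable_deriv _).mul (by fun_prop)).ennreal_ofReal
      _ ≤ liminf (fun n => E - ENNReal.ofReal (‖G n 0‖ ^ p)) atTop := by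
          refine liminf_le_liminf (Eventually.of_forall fun n => ?_)
          refine ENNReal.le_sub_of_add_le_left ENNReal.ofReal_ne_top (hE n)
      _ = _ := (ENNReal.Tendsto.sub tendsto_const_nhds ha
          (Or.inr ENNReal.ofReal_ne_top)).liminf_eq
  calc dirichletEnergy α p F ≤ ENNReal.ofReal (‖F 0‖ ^ p) + (E - ENNReal.ofReal (‖F 0‖ ^ p)) :=
        add_le_add le_rfl hIE
    _ = E := add_tsub_cancel_of_le haE

/-- A nonzero analytic function has finitely many zeros in a smaller closed disc, so only finitely
many radii below `b` are excluded. -/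
theorem exists_radius_forall_ne_zero {f : ℂ → ℂ} (hf : DifferentiableOn ℂ f (ball 0 1))
    (hne : ∃ z ∈ ball (0 : ℂ) 1, f z ≠ 0) {a : ℝ} (ha : a < 1) :
    ∃ R ∈ Ioo a 1, ∀ z, ‖z‖ = R → f z ≠ 0 := by
  obtain ⟨b, hab, hb⟩ := exists_between ha
  obtain ⟨z₀, hz₀, hfz₀⟩ := hne
  have han : AnalyticOnNhd ℂ f (ball 0 1) := hf.analyticOnNhd isOpen_ball
  have hcod := han.preimage_zero_mem_codiscreteWithin hfz₀ hz₀
    ((convex_ball (0 : ℂ) 1).isConnected ⟨0, by simp⟩)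
  have hfin := (isCompact_closedBall (0 : ℂ) b).finite_sdiff_of_mem_codiscreteWithin
    (codiscreteWithin_mono (closedBall_subset_ball hb) hcod)
  obtain ⟨R, hR, hRn⟩ := ((Ioo_infinite hab).sdiff (hfin.image norm)).nonempty
  refine ⟨R, ⟨hR.1, hR.2.trans hb⟩, fun z hz h0 => hRn ⟨z, ⟨?_, ?_⟩, hz⟩⟩
  · rw [mem_closedBall_zero_iff, hz]; exact hR.2.le
  · simpa using h0

theorem tendsto_integralMean_moebiusOp {α p : ℝ} (hα : 0 < α) (hp : 0 < p) {f : ℂ → ℂ}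
    (hf : ContinuousOn f (ball 0 1)) {w : ℂ} (hw : ‖w‖ < 1) {R : ℕ → ℝ}
    (hR : ∀ n, R n ∈ Icc (0 : ℝ) 1) (hR1 : Tendsto R atTop (𝓝 1)) {r : ℝ} (hr : r ∈ Ioo (0 : ℝ) 1) :
    Tendsto (fun n => integralMean p (moebiusOp w (α / p) (fun z => f (R n * z))) r) atTop
      (𝓝 (integralMean p (moebiusOp w (α / p) f) r)) := by
  have hz : ∀ θ, ‖circleMap 0 r θ‖ < 1 := fun θ => by
    rw [norm_circleMap_zero, abs_of_pos hr.1]; exact hr.2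
  have hre : ∀ θ, 0 < (1 - conj w * circleMap 0 r θ).re := fun θ =>
    re_one_sub_conj_mul_pos hw (hz θ).le
  -- The dilation factor ranges over the closed interval, with `1` included: the involution maps the
  -- circle of radius `r < 1` inside the open disc, so `Ψ` is jointly continuous up to that
  -- endpoint.
  set Ψ : Icc (0 : ℝ) 1 → ℝ → ℝ := fun x θ =>
    ‖f ((x : ℝ) * discInvolution w (circleMap 0 r θ))‖ ^ p * discJacobian w (circleMap 0 r θ) ^ α
    with hΨ
  have hφ : Continuous fun θ => discInvolution w (circleMap 0 r θ) :=
    Continuous.div (by fun_prop) (by fun_prop) fun θ => ne_zero_of_re_pos (hre θ)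
  have hJ : Continuous fun θ => discJacobian w (circleMap 0 r θ) :=
    Continuous.div (by fun_prop) (by fun_prop) fun θ =>
      pow_ne_zero 2 (norm_ne_zero_iff.2 (ne_zero_of_re_pos (hre θ)))
  have hΨc : Continuous (Function.uncurry Ψ) := by
    have h1 : Continuous fun q : Icc (0 : ℝ) 1 × ℝ =>
        f (((q.1 : ℝ) : ℂ) * discInvolution w (circleMap 0 r q.2)) := by
      refine hf.comp_continuous ((Complex.continuous_ofReal.comp
        (continuous_subtype_val.comp continuous_fst)).mul (hφ.comp continuous_snd)) fun q => ?_
      rw [mem_ball_zero_iff, norm_mul, Complex.norm_real, norm_of_nonneg q.1.2.1]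
      exact (mul_le_of_le_one_left (norm_nonneg _) q.1.2.2).trans_lt
        (norm_discInvolution_lt_one hw (hz _))
    exact (h1.norm.rpow_const fun _ => Or.inr hp.le).mul
      ((hJ.comp continuous_snd).rpow_const fun _ => Or.inr hα.le)
  have hc := (intervalIntegral.continuous_parametric_intervalIntegral_of_continuous' (μ := volume)
    hΨc 0 (2 * π)).const_smul (2 * π)⁻¹
  have e : ∀ x : Icc (0 : ℝ) 1, integralMean p (moebiusOp w (α / p) (fun z => f ((x : ℝ) * z))) r =
      (2 * π)⁻¹ • ∫ θ in 0..2 * π, Ψ x θ := fun x => by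
    rw [integralMean, circleAverage_def]
    congr 2
    ext θ
    exact norm_moebiusOp_rpow hw hp (hre θ) _
  have e1 := e ⟨1, zero_le_one, le_rfl⟩
  simp only [Complex.ofReal_one, one_mul] at e1
  rw [e1]
  have hR' : Tendsto (fun n => (⟨R n, hR n⟩ : Icc (0 : ℝ) 1)) atTop (𝓝 ⟨1, zero_le_one, le_rfl⟩) :=
    tendsto_subtype_rng.2 hR1
  refine ((hc.tendsto _).comp hR').congr fun n => ?_
  exact (e ⟨R n, hR n⟩).symm

theorem dirichletEnergy_moebiusOp_le {α p : ℝ} (hα : 0 < α) (hp : 0 < p) {f : ℂ → ℂ}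
    (hf : DifferentiableOn ℂ f (ball 0 1)) {w : ℂ} (hw : ‖w‖ < 1) :
    dirichletEnergy α p (moebiusOp w (α / p) f) ≤ dirichletEnergy α p f := by
  have hinj := ENNReal.rpow_left_injective (one_div_ne_zero hp.ne')
  have hdisc : ∀ z ∈ ball (0 : ℂ) 1,
      0 < (1 - conj w * z).re ∧ discInvolution w z ∈ ball (0 : ℂ) 1 := fun z hz => by
    rw [mem_ball_zero_iff] at hz ⊢
    exact ⟨re_one_sub_conj_mul_pos hw hz.le, norm_discInvolution_lt_one hw hz⟩
  by_cases hne : ∃ z ∈ ball (0 : ℂ) 1, f z ≠ 0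
  swap
  · push Not at hne
    refine (hinj (dirichletNorm_congr fun z hz => ?_)).le
    rw [moebiusOp, show (w - z) / (1 - conj w * z) = discInvolution w z from rfl,
      hne _ (hdisc z hz).2, hne z hz, zero_mul]
  have hex : ∀ n : ℕ, ∃ R ∈ Ioo (1 - 1 / ((n : ℝ) + 1)) 1, ∀ z, ‖z‖ = R → f z ≠ 0 := fun n =>
    exists_radius_forall_ne_zero hf hne (sub_lt_self _ (by positivity))
  choose R hRmem hRne using hex
  have hR0 : ∀ n, 0 < R n := fun n => by
    refine lt_of_le_of_lt ?_ (hRmem n).1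
    rw [sub_nonneg, div_le_one (by positivity)]
    linarith [(Nat.cast_nonneg n : (0 : ℝ) ≤ n)]
  have hR1 : Tendsto R atTop (𝓝 1) := by
    refine tendsto_of_tendsto_of_tendsto_of_le_of_le (g := fun n : ℕ => 1 - 1 / ((n : ℝ) + 1))
      (h := fun _ => 1) ?_ tendsto_const_nhds (fun n => (hRmem n).1.le) fun n => (hRmem n).2.le
    simpa using tendsto_one_div_add_atTop_nhds_zero_nat.const_sub (1 : ℝ)
  have hdil : ∀ n, DifferentiableOn ℂ (fun z => f (R n * z)) (ball 0 (R n)⁻¹) := fun n => by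
    refine hf.comp (by fun_prop) fun z hz => ?_
    rw [mem_ball_zero_iff] at hz ⊢
    rw [norm_mul, Complex.norm_real, norm_of_nonneg (hR0 n).le]
    calc R n * ‖z‖ < R n * (R n)⁻¹ := mul_lt_mul_of_pos_left hz (hR0 n)
      _ = 1 := mul_inv_cancel₀ (hR0 n).ne'
  have hRinv : ∀ n, 1 < (R n)⁻¹ := fun n => (one_lt_inv₀ (hR0 n)).2 (hRmem n).2
  refine dirichletEnergy_le_of_tendsto hp
    (G := fun n => moebiusOp w (α / p) (fun z => f (R n * z)))
    (differentiableOn_moebiusOp isOpen_ball hf hdisc) (fun n =>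
      differentiableOn_moebiusOp isOpen_ball
        ((hdil n).mono (ball_subset_ball (hRinv n).le)) hdisc) ?_
    (fun r hr => tendsto_integralMean_moebiusOp hα hp hf.continuousOn hw
      (fun n => ⟨(hR0 n).le, (hRmem n).2.le⟩) hR1 hr) fun n => ?_
  · have hw' : w ∈ ball (0 : ℂ) 1 := mem_ball_zero_iff.2 hw
    have h1 : Tendsto (fun n => f (R n * w)) atTop (𝓝 (f w)) := by
      refine ((hf.continuousOn.continuousAt (isOpen_ball.mem_nhds hw')).tendsto).comp ?_
      have := ((Complex.continuous_ofReal.tendsto 1).comp hR1).mul_const w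
      simpa using this
    simpa [moebiusOp] using h1.mul_const (((1 - ‖w‖ ^ 2) ^ (α / p) : ℝ) : ℂ)
  · have h1 := dirichletNorm_moebiusOp_of_ball hα hp (hRinv n) (hdil n) (fun z hz => hRne n _ (by
      rw [norm_mul, Complex.norm_real, norm_of_nonneg (hR0 n).le, hz, mul_one])) hw
    exact (hinj h1).le.trans (dirichletEnergy_comp_mul_le hp hf (hR0 n) (hRmem n).2)

/-- The chain rule relation `J(φ(z)) J(z) = 1` cancels the weights. Comparing moduli avoids any
discussion of branches, and the norm sees only moduli. -/
theorem norm_moebiusOp_moebiusOp {α p : ℝ} (hp : 0 < p) {w z : ℂ} (hw : ‖w‖ < 1)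
    (hz : ‖z‖ < 1) (f : ℂ → ℂ) :
    ‖moebiusOp w (α / p) (moebiusOp w (α / p) f) z‖ = ‖f z‖ := by
  have h1 := re_one_sub_conj_mul_pos hw hz.le
  have h2 := re_one_sub_conj_mul_pos hw (norm_discInvolution_lt_one hw hz).le
  refine (rpow_left_inj (norm_nonneg _) (norm_nonneg _) hp.ne').1 ?_
  rw [norm_moebiusOp_rpow hw hp h1, norm_moebiusOp_rpow hw hp h2,
    discInvolution_discInvolution hw h1, mul_assoc,
    ← mul_rpow (discJacobian_pos hw h2).le (discJacobian_pos hw h1).le]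
  have hJ : discJacobian w (discInvolution w z) * discJacobian w z = 1 := by
    have hd := one_sub_norm_sq_pos hz
    have e1 := one_sub_norm_discInvolution_sq h1
    have e2 := one_sub_norm_discInvolution_sq h2
    rw [discInvolution_discInvolution hw h1, e1, ← mul_assoc] at e2
    exact (mul_eq_right₀ hd.ne').1 e2.symm
  rw [hJ, one_rpow, mul_one]

theorem theorem1p1 (α p : ℝ) (hα : 0 < α) (hp : 0 < p) (f : ℂ → ℂ) (hf : f ∈ classA α p)
    (w : ℂ) (hw : w ∈ Metric.ball (0 : ℂ) 1) :
    moebiusOp w (α / p) f ∈ classA α p ∧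
      dirichletNorm α p f = dirichletNorm α p (moebiusOp w (α / p) f) := by
  rw [mem_ball_zero_iff] at hw
  have hT : DifferentiableOn ℂ (moebiusOp w (α / p) f) (ball 0 1) :=
    differentiableOn_moebiusOp isOpen_ball hf.1 fun z hz => by
      rw [mem_ball_zero_iff] at hz ⊢
      exact ⟨re_one_sub_conj_mul_pos hw hz.le, norm_discInvolution_lt_one hw hz⟩
  have hle : ∀ g : ℂ → ℂ, DifferentiableOn ℂ g (ball 0 1) →
      dirichletNorm α p (moebiusOp w (α / p) g) ≤ dirichletNorm α p g := fun g hg =>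
    ENNReal.rpow_le_rpow (dirichletEnergy_moebiusOp_le hα hp hg hw) (one_div_pos.2 hp).le
  have heq : dirichletNorm α p f = dirichletNorm α p (moebiusOp w (α / p) f) := by
    refine le_antisymm ?_ (hle f hf.1)
    -- The reverse inequality is the contraction property applied to the transform of `f`.
    rw [← dirichletNorm_congr fun z hz =>
      norm_moebiusOp_moebiusOp hp hw (mem_ball_zero_iff.1 hz) f]
    exact hle _ hT
  exact ⟨⟨hT, heq ▸ hf.2⟩, heq⟩
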